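/- **Conventions.** Automata are finite, input-complete parity automata on infinite words with transition-based acceptance, in which the color of a transition depends only on its source state and its letter; a run is accepting if the least color occurring infinitely often is even, and the size of an automaton is its number of states. A DPW is a deterministic such automaton. A co-Büchi automaton uses only the colors $1$ (rejecting) and $2$ (accepting). An HD-tCBW is a history-deterministic co-Büchi automaton $A$: there is $f:\Sigma^*\to Q$ such that $f(\varepsilon), f(w_0), f(w_0w_1),\dots$ is an accepting run for each $w=w_0w_1\ldots\in\mathcal L(A)$. For $L\subseteq\Sigma^\omega$ and $u\in\Sigma^*$ let $L|_u=\{w\mid uw\in L\}$. A word $w=w_0w_1\ldots$ is *at home* in color $i\in\mathbb N$ (w.r.t. $L$) if there is an infinite set $J\subseteq\mathbb N$ such that every word $w'$ obtained from $w$ by inserting, after positions $j\in J$, finite words $u_j$ with $L|_{w_0\ldots w_j}=L|_{w_0\ldots w_ju_j}$ is at home in some color less than $i$, or satisfies ($w,w'\in L$ and $i$ is even) or ($w,w'\notin L$ and $i$ is odd). The *natural color* of $w$ is the least color in which $w$ is at home. A chain $L_1,\dots,L_n$ of languages (with $L_0=\Sigma^\omega$) represents the set $\mathcal L(L_1,\dots,L_n)$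 of words for which the highest $i$ with $w\in L_i$ is even. A *COCOA* for $L$ is a chain $(A_1,\dots,A_n)$ of HD-tCBW with $\mathcal L(A_1)\supsetneq\dots\supsetneq\mathcal L(A_n)$ that represents $L$, such that $\mathcal L(A_i)$ is the set of words of natural color at least $i$ for $1\le i\le n$, and no word has a natural color greater than $n$. For $k\ge 1$ let $\Sigma=\{X_1,\dots,X_k,Y_1,\dots,Y_k,a_0,\dots,a_{4k-1}\}$, and for $1\le i\le k$ let $$L^k_i=((\Sigma\setminus\{X_i\})+X_i(\Sigma\setminus\{X_i\})^*X_i)^*(a_0+\dots+a_{4k-2i+1})^\omega+\Sigma^*(a_0+\dots+a_{4k-2i})^\omega,$$ $$\hat L^k_i=((\Sigma\setminus\{Y_i\})+Y_i(\Sigma\setminus\{Y_i\})^*Y_i)^*(a_{2i-2}+\dots+a_{4k-1})^\omega+\Sigma^*(a_{2i-1}+\dots+a_{4k-1})^\omega,$$ and $L^k=\mathcal L(L^k_1,\dots,L^k_k)$, $\hat L^k=\mathcal L(\hat L^k_1,\dots,\hat L^k_k)$. **Statement.** Exponential conciseness of COCOA over DPW can be lost under disjunction. Precisely, for every $k\ge1$: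 1. Each of $L^k$ and $\hat L^k$ has a COCOA consisting of $k$ automata with two states each, whereas the smallest DPW for each of them has exactly $2^k$ states. 2. If $U$ is an HD-tCBW with $\mathcal L(U)=\Sigma^\omega$ and $(A_1,\dots,A_n)$ is a COCOA for $L^k$ (resp. $\hat L^k$), then $(U,A_1,\dots,A_n)$ is a COCOA for $\Sigma^\omega\setminus L^k$ (resp. $\Sigma^\omega\setminus\hat L^k$). 3. The conjunction $(\Sigma^\omega\setminus L^k)\cap(\Sigma^\omega\setminus\hat L^k)$ has a COCOA. Every COCOA for it is non-empty, its first automaton accepts $\Sigma^\omega$, and removing this automaton yields a COCOA for $L^k\cup\hat L^k$. 4. In every COCOA $(D_1,\dots,D_n)$ for $L^k\cup\hat L^k$ we have $n\ge k$, and $D_u$ has at least $2^{u+1}$ states for all $1\le u\le k$. In particular, $D_k$ has at least $2^{k+1}$ states. 5. In contrast, complementing DPW causes no blow-up: for every DPW over a finite alphabet, adding $1$ to the color of every transition yields a DPW of the same size for the complement language. Moreover, there is a DPW for $L^k\cup\hat L^k$ with at most $2^{4k^2}\cdot k^{2k}$ states. -/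

import Mathlib

namespace Cocoa

open Filter

variable {α : Type}

/-! ### Infinite words and residual languages -/

/-- A language of infinite words over `α`. -/
abbrev OmegaLanguage (α : Type) : Type := Set (Stream' α)

/-- The residual language of `L` over the finite word `u`. -/
def residual (L : OmegaLanguage α) (u : List α) : OmegaLanguage α :=
  {w | u ++ₛ w ∈ L}

/-- The finite word `w₀ u₀ w₁ u₁ … wₙ₋₁ uₙ₋₁`. -/
def blocks (w : Stream' α) (u : ℕ → List α) (n : ℕ) : List α :=
  (List.range n).flatMap fun i => w.get i :: u i

/-- `w'` is the infinite word `w₀ u₀ w₁ u₁ w₂ u₂ …`, i.e. the result of injecting the (possibly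
empty) finite word `u i` into `w` right after position `i`, for all `i` at once. -/
def IsInjection (w : Stream' α) (u : ℕ → List α) (w' : Stream' α) : Prop :=
  ∀ n, ∃ v : Stream' α, w' = blocks w u n ++ₛ v

/-- `w'` results from `w` by injecting residual language invariant finite words at positions
in `J`. -/
def Extends (L : OmegaLanguage α) (J : Set ℕ) (w w' : Stream' α) : Prop :=
  ∃ u : ℕ → List α, (∀ i, i ∉ J → u i = []) ∧
    (∀ i, residual L (w.take (i + 1)) = residual L (w.take (i + 1) ++ u i)) ∧
    IsInjection w u w'

/-- `w` is at home in color `i` with respect to `L`. The injection points form an infinite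
sequence of positions. -/
def AtHome (L : OmegaLanguage α) (i : ℕ) (w : Stream' α) : Prop :=
  ∃ J : Set ℕ, J.Infinite ∧ ∀ w', Extends L J w w' →
    (∃ j, ∃ _ : j < i, AtHome L j w') ∨
      (w ∈ L ∧ w' ∈ L ∧ Even i) ∨ (w ∉ L ∧ w' ∉ L ∧ Odd i)
termination_by i

/-- The natural color of `w` with respect to `L`: the least color in which `w` is at home
(`⊤` if there is none, which does not happen for `ω`-regular languages). -/
noncomputable def naturalColor (L : OmegaLanguage α) (w : Stream' α) : ℕ∞ :=
  ⨅ (i : ℕ) (_ : AtHome L i w), (i : ℕ∞)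

/-! ### Parity automata with transition-based acceptance -/

/-- Input-complete parity automata in which the color of a transition is determined by its source
state and its letter. -/
structure ParityAutomaton (α : Type) where
  State : Type
  finite_state : Finite State
  init : State
  step : State → α → Set State
  step_nonempty : ∀ q x, (step q x).Nonempty
  color : State → α → ℕ

namespace ParityAutomaton

variable (A : ParityAutomaton α)

/-- The size of an automaton is its number of states. -/
noncomputable def size : ℕ := Nat.card A.State

/-- `r` is a run of `A` on `w`. -/
def IsRun (w : Stream' α) (r : ℕ → A.State) : Prop :=
  r 0 = A.init ∧ ∀ n, r (n + 1) ∈ A.step (r n) (w.get n)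

/-- `r` is a run on `w` for which the lowest color that occurs infinitely often is even. -/
def IsAcceptingRun (w : Stream' α) (r : ℕ → A.State) : Prop :=
  A.IsRun w r ∧
    ∃ c, Even c ∧ IsLeast {c | ∃ᶠ n in atTop, A.color (r n) (w.get n) = c} c

/-- The language of `A`. -/
def language : OmegaLanguage α := {w | ∃ r, A.IsAcceptingRun w r}

/-- Deterministic parity automata (DPW). -/
def IsDeterministic : Prop := ∀ q x, ∃! q', q' ∈ A.step q x

/-- Co-Büchi automata: color `1` is rejecting, color `2` is accepting. -/
def IsCoBuchi : Prop := ∀ q x, A.color q x = 1 ∨ A.color q x = 2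

/-- There is an advice function that yields an accepting run on each word of the language. -/
def IsHistoryDeterministic : Prop :=
  ∃ f : List α → A.State, ∀ w ∈ A.language, A.IsAcceptingRun w fun n => f (w.take n)

/-- History-deterministic co-Büchi automata with transition-based acceptance. -/
def IsHDtCBW : Prop := A.IsCoBuchi ∧ A.IsHistoryDeterministic

/-- Add `1` to the color of every transition. -/
def addOne : ParityAutomaton α := { A with color := fun q x => A.color q x + 1 }

end ParityAutomaton

/-! ### Chains of co-Büchi automata -/

/-- The language represented by a chain `M 1 ⊇ M 2 ⊇ …` of languages, where `M 0` contains all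
words and `M i` is empty for `i` larger than the length of the chain: `w` is in it if and only if
the highest index `i` with `w ∈ M i` is even. -/
def chainLanguage (M : ℕ → OmegaLanguage α) : OmegaLanguage α :=
  {w | ∃ m, Even m ∧ IsGreatest {i | w ∈ M i} m}

/-- The language of the `i`-th automaton of the chain `C = (A₁, …, Aₙ)`, with the convention that
all words are in level `0` and that the levels above `n` are empty. -/
def level (C : List (ParityAutomaton α)) : ℕ → OmegaLanguage α
  | 0 => Set.univ
  | i + 1 => {w | ∃ A, C[i]? = some A ∧ w ∈ A.language}

/-- `C` is a COCOA for `L`: a falling chain of history-deterministic co-Büchi automata that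
represents `L` and in which, for every `i`, the words in level `i` are precisely those with a
natural color of at least `i`. -/
structure IsCOCOA (L : OmegaLanguage α) (C : List (ParityAutomaton α)) : Prop where
  isHDtCBW : ∀ A ∈ C, A.IsHDtCBW
  falling : ∀ i, 1 ≤ i → i < C.length → level C (i + 1) ⊂ level C i
  represents : chainLanguage (level C) = L
  mem_level_iff : ∀ i w, w ∈ level C i ↔ (i : ℕ∞) ≤ naturalColor L w

/-! ### The two families of languages -/

/-- The alphabet `{X₁, …, X_k, Y₁, …, Y_k, a₀, …, a_{4k-1}}`. -/
inductive Letter (k : ℕ) : Type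
  | X (i : Set.Icc 1 k)
  | Y (i : Set.Icc 1 k)
  | a (h : Fin (4 * k))

/-- The finite words that consist of one letter from `S`. -/
def letters (S : Set α) : Language α := {u | ∃ x ∈ S, u = [x]}

open Computability in
/-- The regular expression `((Σ ∖ {x}) + x (Σ ∖ {x})* x)*`. -/
def evenlyMany (x : α) : Language α :=
  (letters {x}ᶜ + letters {x} * (letters {x}ᶜ)∗ * letters {x})∗

/-- The `ω`-regular expression `R S^ω` for a set `S` of letters. -/
def thenForever (R : Language α) (S : Set α) : OmegaLanguage α :=
  {w | ∃ u ∈ R, ∃ v : Stream' α, (∀ n, v.get n ∈ S) ∧ w = u ++ₛ v}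

/-- The letters `a_lo, …, a_hi`. -/
def aRange (k lo hi : ℕ) : Set (Letter k) :=
  {x | ∃ h : Fin (4 * k), lo ≤ (h : ℕ) ∧ (h : ℕ) ≤ hi ∧ x = Letter.a h}

/-- The language `L^k_i`. -/
def Lpart (k : ℕ) (i : Set.Icc 1 k) : OmegaLanguage (Letter k) :=
  thenForever (evenlyMany (Letter.X i)) (aRange k 0 (4 * k - 2 * i + 1)) ∪
    thenForever ⊤ (aRange k 0 (4 * k - 2 * i))

/-- The language `L̂^k_i`. -/
def Lhatpart (k : ℕ) (i : Set.Icc 1 k) : OmegaLanguage (Letter k) :=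
  thenForever (evenlyMany (Letter.Y i)) (aRange k (2 * i - 2) (4 * k - 1)) ∪
    thenForever ⊤ (aRange k (2 * i - 1) (4 * k - 1))

/-- The levels of the chain `F 1, …, F k`: all words for index `0`, none above `k`. -/
def familyLevel {k : ℕ} (F : Set.Icc 1 k → OmegaLanguage α) (i : ℕ) : OmegaLanguage α :=
  {w | i = 0 ∨ ∃ h : i ∈ Set.Icc 1 k, w ∈ F ⟨i, h⟩}

/-- The language `L^k = 𝓛(L^k_1, …, L^k_k)`. -/
def L (k : ℕ) : OmegaLanguage (Letter k) := chainLanguage (familyLevel (Lpart k))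

/-- The language `L̂^k = 𝓛(L̂^k_1, …, L̂^k_k)`. -/
def Lhat (k : ℕ) : OmegaLanguage (Letter k) := chainLanguage (familyLevel (Lhatpart k))

end Cocoa

/-! Everything rests on explicit formulas for natural colors. Call a map from words to numbers a
coloring (`IsColoring`) if its parity decides membership, it never grows under residual-invariant
injections, and it can be lowered by exactly one by injections at any infinite set of positions, as
long as it exceeds a base value of 0 or 1. Such a map is the natural color
(`IsColoring.atHome_iff`), so it determines the levels of every COCOA. Adding 1 turns a coloring
with base 0 into one for the complement. This is why complementing amounts to prepending a universal
automaton.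

For each family the residual language of a prefix is determined by the parities of its marks. Up to
reversing the order of the letters `a h`, the families are the same. A letter has a level in each
family, depending on these parities. The level of a word in a family is the least letter level
occurring infinitely often, and it is a coloring. Each single threshold on it depends on one parity
bit, hence the two-state automata, while a DPW must separate all `2 ^ k` residuals.

For the union, a word on levels `s` and `t` has color `unionColor s t`: 0 if one level is 0, `s + t
- 2` if both are even, and `s + t - 1` otherwise. A threshold `u` on this color mixes bits of both
families. A change of one bit lowers `s` from `i` to `i - 1`, and with a suitable `t` this crosses
the threshold. So `u + 1` bits must be remembered, and history-determinism turns distinct nonempty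
residuals into distinct states (`two_pow_le_size`). Conversely, the threshold is a disjunction of
`k` co-Büchi conditions over the parities. Cycling through them with pointers
(`eventuallyOnRun_pointerStep_iff`) gives both a COCOA and a DPW for the union. -/

namespace Cocoa

open Filter

variable {α : Type}

/-! ### The least value that occurs infinitely often -/

/-- The least value that occurs infinitely often in a sequence of natural numbers. -/
noncomputable def limMin (g : ℕ → ℕ) : ℕ := sInf {c | ∃ᶠ n in atTop, g n = c}

/-- Pigeonhole: only finitely many values lie below `i`. -/
theorem exists_frequently_eq_of_frequently_lt {g : ℕ → ℕ} {i : ℕ} (h : ∃ᶠ n in atTop, g n < i) :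
    ∃ c < i, ∃ᶠ n in atTop, g n = c := by
  by_contra! hc
  refine h ?_
  have h2 : ∀ᶠ n in atTop, ∀ c ∈ Finset.range i, g n ≠ c :=
    (Finset.eventually_all _).2 fun c hc' => by simpa using hc c (by simpa using hc')
  filter_upwards [h2] with n hn hlt
  exact hn (g n) (by simpa using hlt) rfl

theorem isLeast_limMin {g : ℕ → ℕ} {B : ℕ} (h : ∀ n, g n ≤ B) :
    IsLeast {c | ∃ᶠ n in atTop, g n = c} (limMin g) := by
  obtain ⟨c, -, hc⟩ := exists_frequently_eq_of_frequently_lt (g := g) (i := B + 1)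
    (Eventually.frequently (Eventually.of_forall fun n => Nat.lt_succ_of_le (h n)))
  exact ⟨Nat.sInf_mem ⟨c, hc⟩, fun d hd => Nat.sInf_le hd⟩

theorem le_limMin_iff {g : ℕ → ℕ} {B : ℕ} (h : ∀ n, g n ≤ B) {i : ℕ} :
    i ≤ limMin g ↔ ∀ᶠ n in atTop, i ≤ g n := by
  have hl := isLeast_limMin h
  constructor
  · intro hi
    by_contra hc
    obtain ⟨c, hci, hc⟩ := exists_frequently_eq_of_frequently_lt (g := g) (i := i)
      (by simpa [Filter.Frequently] using hc)
    exact absurd (hl.2 hc) (by omega)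
  · intro hi
    obtain ⟨n, hn, hn'⟩ := (Frequently.and_eventually hl.1 hi).exists
    omega

/-! ### Natural colors -/

theorem isInjection_nil (w : Stream' α) : IsInjection w (fun _ => []) w := by
  intro n
  refine ⟨w.drop n, ?_⟩
  have : blocks w (fun _ => []) n = w.take n := by
    induction n with
    | zero => rfl
    | succ n ih => rw [Stream'.take_succ', ← ih]; simp [blocks, List.range_succ]
  rw [this, Stream'.append_take_drop]

theorem extends_self (L : OmegaLanguage α) (J : Set ℕ) (w : Stream' α) : Extends L J w w :=
  ⟨fun _ => [], fun _ _ => rfl, fun i => by simp, isInjection_nil w⟩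

theorem residual_compl (L : OmegaLanguage α) (u : List α) : residual Lᶜ u = (residual L u)ᶜ := rfl

theorem extends_compl (L : OmegaLanguage α) : Extends Lᶜ = Extends L := by
  ext J w w'
  simp only [Extends, residual_compl, compl_inj_iff]

/-- `d` is a coloring of words by numbers from `b` on that refines membership in `L`, does not
increase under injections and can be lowered step by step by injections. -/
structure IsColoring (L : OmegaLanguage α) (b : ℕ) (d : Stream' α → ℕ) : Prop where
  mem_iff : ∀ w, w ∈ L ↔ Even (d w)
  le_of_extends : ∀ J w w', Extends L J w w' → d w' ≤ d w
  exists_extends : ∀ J w, J.Infinite → b < d w → ∃ w', Extends L J w w' ∧ d w' + 1 = d w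

theorem IsColoring.compl {L : OmegaLanguage α} {d : Stream' α → ℕ} (h : IsColoring L 0 d) :
    IsColoring Lᶜ 1 (fun w => d w + 1) where
  mem_iff w := by simp [h.mem_iff, Nat.even_add_one]
  le_of_extends J w w' hw := by
    rw [extends_compl] at hw
    exact Nat.succ_le_succ (h.le_of_extends J w w' hw)
  exists_extends J w hJ hw := by
    rw [extends_compl]
    obtain ⟨w', h1, h2⟩ := h.exists_extends J w hJ (by omega)
    exact ⟨w', h1, by omega⟩

/-- Induction on `i`. If the color of `w` exceeds `i`, every choice of `J` is defeated by an
injection that lowers the color by one. If it is at most `i`, all positions may serve as `J`,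
because injections never raise the color. -/
theorem IsColoring.atHome_iff {L : OmegaLanguage α} {b : ℕ} {d : Stream' α → ℕ}
    (h : IsColoring L b d) (hb : b ≤ 1) (i : ℕ) : ∀ w, AtHome L i w ↔ d w ≤ i := by
  induction i using Nat.strong_induction_on with
  | _ i ih =>
  intro w
  rw [AtHome]
  constructor
  · rintro ⟨J, hJ, hall⟩
    by_contra! hlt
    by_cases hbd : b < d w
    -- The color of `w'` is still at least `i`, so no smaller color is a home for it, and its parity
    -- differs from that of `w`.
    · obtain ⟨w', he, hd⟩ := h.exists_extends J w hJ hbd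
      rcases hall w' he with ⟨j, hj, hh⟩ | ⟨h1, h2, -⟩ | ⟨h1, h2, -⟩
      · have := (ih j hj w').1 hh
        omega
      · rw [h.mem_iff] at h1 h2
        rw [← hd] at h1
        exact (Nat.even_add_one.1 h1) h2
      · rw [h.mem_iff] at h1 h2
        rw [← hd, Nat.even_add_one] at h1
        exact h1 h2
    -- Only base 1 is left. The word cannot be lowered, but its color 1 excludes it from `L`, as
    -- color 0 would require membership.
    · have hi : i = 0 := by omega
      have hd : d w = 1 := by omega
      subst hi
      rcases hall w (extends_self L J w) with ⟨j, hj, -⟩ | ⟨h1, -, -⟩ | ⟨-, -, h3⟩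
      · omega
      · rw [h.mem_iff, hd] at h1
        exact absurd h1 (by decide)
      · exact absurd h3 (by decide)
  · intro hle
    refine ⟨Set.univ, Set.infinite_univ, fun w' he => ?_⟩
    have hle' := h.le_of_extends _ _ _ he
    by_cases hlt : d w' < i
    · exact Or.inl ⟨d w', hlt, (ih _ hlt w').2 le_rfl⟩
    · right
      have e1 : d w = i := by omega
      have e2 : d w' = i := by omega
      simp only [h.mem_iff, e1, e2, Nat.not_even_iff_odd, and_self]
      exact Nat.even_or_odd i

theorem IsColoring.naturalColor_eq {L : OmegaLanguage α} {b : ℕ} {d : Stream' α → ℕ}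
    (h : IsColoring L b d) (hb : b ≤ 1) (w : Stream' α) : naturalColor L w = d w := by
  rw [naturalColor]
  apply le_antisymm
  · exact iInf₂_le (d w) ((h.atHome_iff hb _ w).2 le_rfl)
  · exact le_iInf₂ fun i hi => Nat.cast_le.2 ((h.atHome_iff hb _ w).1 hi)

theorem chainLanguage_eq {M : ℕ → OmegaLanguage α} {d : Stream' α → ℕ}
    (h : ∀ i w, w ∈ M i ↔ i ≤ d w) : chainLanguage M = {w | Even (d w)} := by
  ext w
  have hg : IsGreatest {i | w ∈ M i} (d w) :=
    ⟨(h _ _).2 le_rfl, fun i hi => (h _ _).1 hi⟩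
  constructor
  · rintro ⟨m, hm, hm'⟩
    rw [hm'.unique hg] at hm
    exact hm
  · exact fun hw => ⟨d w, hw, hg⟩

theorem IsColoring.mem_level_iff {L : OmegaLanguage α} {b : ℕ} {d : Stream' α → ℕ}
    (h : IsColoring L b d) (hb : b ≤ 1) {C : List (ParityAutomaton α)} (hC : IsCOCOA L C)
    (i : ℕ) (w : Stream' α) : w ∈ level C i ↔ i ≤ d w := by
  rw [hC.mem_level_iff, h.naturalColor_eq hb, Nat.cast_le]

theorem IsColoring.exists_eq {L : OmegaLanguage α} {b : ℕ} {d : Stream' α → ℕ}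
    (h : IsColoring L b d) {w : Stream' α} {i : ℕ} (hbi : b ≤ i) (hi : i ≤ d w) :
    ∃ w', d w' = i := by
  induction hi using Nat.decreasingInduction with
  | self => exact ⟨w, rfl⟩
  | of_succ j hj ih =>
    obtain ⟨w', hw'⟩ := ih (by omega)
    obtain ⟨w'', -, h2⟩ := h.exists_extends Set.univ w' Set.infinite_univ (by omega)
    exact ⟨w'', by omega⟩

/-- One word of large color suffices for strictness: lowering it step by step realizes every color
in between, and a word of color exactly `i` separates level `i` from level `i + 1`. -/
theorem IsColoring.isCOCOA {L : OmegaLanguage α} {b : ℕ} {d : Stream' α → ℕ}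
    (h : IsColoring L b d) (hb : b ≤ 1) {C : List (ParityAutomaton α)}
    (hHD : ∀ A ∈ C, A.IsHDtCBW) (hlev : ∀ i w, w ∈ level C i ↔ i ≤ d w)
    (hmax : ∃ w, C.length ≤ d w + 1) : IsCOCOA L C where
  isHDtCBW := hHD
  falling i h1 h2 := by
    obtain ⟨w, hw⟩ := hmax
    obtain ⟨w', hw'⟩ := h.exists_eq (w := w) (i := i) (by omega) (by omega)
    refine (Set.ssubset_iff_of_subset fun v hv => ?_).2 ⟨w', ?_, ?_⟩
    · rw [hlev] at hv ⊢; omega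
    · rw [hlev, hw']
    · rw [hlev, hw']; omega
  represents := by
    rw [chainLanguage_eq hlev]
    ext w
    exact (h.mem_iff w).symm
  mem_level_iff i w := by rw [hlev, h.naturalColor_eq hb, Nat.cast_le]

/-! ### Shifting a chain by a universal first level -/

theorem level_cons_add_two (U : ParityAutomaton α) (C : List (ParityAutomaton α)) (i : ℕ) :
    level (U :: C) (i + 2) = level C (i + 1) := by
  simp [level]

theorem level_cons_one (U : ParityAutomaton α) (C : List (ParityAutomaton α)) :
    level (U :: C) 1 = U.language := by
  ext w
  simp [level]

theorem mem_level_cons_iff {U : ParityAutomaton α} (hU : U.language = Set.univ)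
    {C : List (ParityAutomaton α)} {d : Stream' α → ℕ} :
    (∀ i w, w ∈ level (U :: C) i ↔ i ≤ d w + 1) ↔ (∀ i w, w ∈ level C i ↔ i ≤ d w) := by
  constructor
  · intro h i w
    rcases i with _ | i
    · simp [level]
    · rw [← level_cons_add_two U, h]; omega
  · intro h i w
    rcases i with _ | _ | i
    · simp [level]
    · simp [level_cons_one, hU]
    · rw [level_cons_add_two, h]; omega

/-- Prepending a universal automaton complements a COCOA. -/
theorem IsColoring.isCOCOA_cons {L : OmegaLanguage α} {d : Stream' α → ℕ}
    (h : IsColoring L 0 d) [Nonempty α] {U : ParityAutomaton α} (hU : U.IsHDtCBW) (hU' : U.language = Set.univ)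
    {C : List (ParityAutomaton α)} (hC : IsCOCOA L C) : IsCOCOA Lᶜ (U :: C) := by
  have hlev := h.mem_level_iff zero_le_one hC
  refine h.compl.isCOCOA le_rfl ?_ ((mem_level_cons_iff hU').2 hlev) ?_
  · intro A hA
    rcases List.mem_cons.1 hA with rfl | hA
    · exact hU
    · exact hC.isHDtCBW A hA
  -- Strictness of the given chain says nothing about level 0, so chains with fewer than two
  -- automata are treated apart; any word works for them.
  · rcases Nat.lt_or_ge C.length 2 with hlt | hge
    · obtain ⟨x⟩ := ‹Nonempty α›
      exact ⟨Stream'.const x, by simp only [List.length_cons]; omega⟩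
    · have hf := hC.falling (C.length - 1) (by omega) (by omega)
      obtain ⟨w, hw, -⟩ := Set.exists_of_ssubset hf
      exact ⟨w, by rw [hlev] at hw; simp only [List.length_cons]; omega⟩

/-- A COCOA for a complement arises by prepending a universal automaton. -/
theorem IsColoring.exists_cons {L : OmegaLanguage α} {d : Stream' α → ℕ}
    (h : IsColoring L 0 d) [Nonempty α] {C : List (ParityAutomaton α)} (hC : IsCOCOA Lᶜ C) :
    ∃ U D, C = U :: D ∧ U.language = Set.univ ∧ IsCOCOA L D := by
  have hlev := h.compl.mem_level_iff le_rfl hC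
  rcases C with _ | ⟨U, D⟩
  · obtain ⟨x⟩ := ‹Nonempty α›
    have := (hlev 1 (Stream'.const x)).2 (by omega)
    simp [level] at this
  have hU : U.language = Set.univ := by
    ext w
    simpa [level_cons_one] using hlev 1 w
  refine ⟨U, D, rfl, hU, ?_⟩
  have hlev' := (mem_level_cons_iff hU).1 hlev
  refine ⟨fun A hA => hC.isHDtCBW A (List.mem_cons_of_mem _ hA), fun i h1 h2 => ?_, ?_,
    fun i w => by rw [hlev', h.naturalColor_eq zero_le_one, Nat.cast_le]⟩
  · obtain ⟨i, rfl⟩ : ∃ j, i = j + 1 := ⟨i - 1, by omega⟩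
    have := hC.falling (i + 2) (by omega) (by simp only [List.length_cons]; omega)
    rwa [level_cons_add_two, level_cons_add_two] at this
  · rw [chainLanguage_eq hlev']
    ext w
    exact (h.mem_iff w).symm

/-! ### Infinite words and their prefixes -/

theorem take_length_append (u : List α) (w : Stream' α) : (u ++ₛ w).take u.length = u := by
  induction u with
  | nil => rfl
  | cons x u ih => rw [List.length_cons, Stream'.cons_append_stream, Stream'.take_succ_cons, ih]

theorem take_append_length_add (u : List α) (w : Stream' α) (n : ℕ) :
    (u ++ₛ w).take (u.length + n) = u ++ w.take n := by
  induction n with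
  | zero => simp [take_length_append]
  | succ n ih =>
    rw [← Nat.add_assoc, Stream'.take_succ', ih, Stream'.take_succ', ← List.append_assoc,
      ← Stream'.get_drop, Stream'.drop_append_stream]

theorem get_append_length_add (u : List α) (w : Stream' α) (n : ℕ) :
    (u ++ₛ w).get (u.length + n) = w.get n := by
  rw [← Stream'.get_drop, Stream'.drop_append_stream]

theorem eventually_add_iff {P : ℕ → Prop} (k : ℕ) :
    (∀ᶠ n in atTop, P (k + n)) ↔ ∀ᶠ n in atTop, P n := by
  conv_rhs => rw [← map_add_atTop_eq_nat k, eventually_map]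
  simp only [Nat.add_comm k]

theorem frequently_add_iff {P : ℕ → Prop} (k : ℕ) :
    (∃ᶠ n in atTop, P (k + n)) ↔ ∃ᶠ n in atTop, P n :=
  not_congr (eventually_add_iff (P := fun n => ¬ P n) k)

theorem blocks_succ (w : Stream' α) (u : ℕ → List α) (n : ℕ) :
    blocks w u (n + 1) = blocks w u n ++ w.get n :: u n := by
  simp [blocks, List.range_succ]

theorem le_length_blocks (w : Stream' α) (u : ℕ → List α) (n : ℕ) :
    n ≤ (blocks w u n).length := by
  induction n with
  | zero => simp
  | succ n ih => rw [blocks_succ]; simp; omega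

/-- The blocks form an increasing sequence of prefixes, and the `i + 1`-st one is long enough to fix
position `i` of the limit. -/
theorem exists_isInjection (w : Stream' α) (u : ℕ → List α) : ∃ w', IsInjection w u w' := by
  have hpre : ∀ n m, n ≤ m → ∃ l, blocks w u m = blocks w u n ++ l := by
    intro n m h
    induction h with
    | refl => exact ⟨[], by simp⟩
    | step _ ih =>
      obtain ⟨l, hl⟩ := ih
      exact ⟨_, by rw [Nat.succ_eq_add_one, blocks_succ, hl, List.append_assoc]⟩
  have hget : ∀ n i (hi : i < (blocks w u n).length),
      (blocks w u n)[i] = (blocks w u (i + 1))[i]'(le_length_blocks w u (i + 1)) := by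
    intro n i hi
    rcases le_total n (i + 1) with h | h <;> obtain ⟨l, hl⟩ := hpre _ _ h
    · simp [hl, List.getElem_append_left hi]
    · simp [hl, List.getElem_append_left (show i < (blocks w u (i + 1)).length from
        le_length_blocks w u (i + 1))]
  let w' : Stream' α := fun i => (blocks w u (i + 1))[i]'(le_length_blocks w u (i + 1))
  refine ⟨w', fun n => ⟨w'.drop (blocks w u n).length, ?_⟩⟩
  have : blocks w u n = w'.take (blocks w u n).length := by
    apply List.ext_getElem?
    intro i
    rcases lt_or_ge i (blocks w u n).length with h | h
    · rw [Stream'.getElem?_take h, List.getElem?_eq_getElem h, hget n i h]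
      rfl
    · rw [List.getElem?_eq_none h, List.getElem?_eq_none (by simpa using h)]
  conv_rhs => rw [this, Stream'.length_take, Stream'.append_take_drop]

/-! ### Deterministic transition systems -/

section Run

variable {S : Type} (δ : S → α → S)

/-- From some point on, all pairs of a state and the letter read there satisfy `Q`, for the
run of the transition function `δ` from `s` on `w`. -/
def EventuallyOnRun (s : S) (Q : S → α → Prop) (w : Stream' α) : Prop :=
  ∀ᶠ n in atTop, Q ((w.take n).foldl δ s) (w.get n)

/-- All pairs of a state and the letter read there satisfy `Q` along a finite word. -/
def AllOnRun (Q : S → α → Prop) : S → List α → Prop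
  | _, [] => True
  | s, x :: u => Q s x ∧ AllOnRun Q (δ s x) u

variable {δ} {s : S} {Q : S → α → Prop}

theorem allOnRun_iff {u : List α} :
    AllOnRun δ Q s u ↔ ∀ p x q, u = p ++ x :: q → Q (p.foldl δ s) x := by
  induction u generalizing s with
  | nil => simp [AllOnRun]
  | cons y u ih =>
    rw [AllOnRun, ih]
    constructor
    · rintro ⟨h1, h2⟩ p x q h
      rcases p with _ | ⟨z, p⟩
      · simp only [List.nil_append, List.cons.injEq] at h
        simpa [← h.1] using h1
      · simp only [List.cons_append, List.cons.injEq] at h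
        simpa [← h.1] using h2 p x q h.2
    · intro h
      exact ⟨h [] y u rfl, fun p x q hu => h (y :: p) x q (by simp [hu])⟩

theorem eventuallyOnRun_append {u : List α} {w : Stream' α} :
    EventuallyOnRun δ s Q (u ++ₛ w) ↔ EventuallyOnRun δ (u.foldl δ s) Q w := by
  rw [EventuallyOnRun, ← eventually_add_iff u.length]
  simp only [take_append_length_add, get_append_length_add, List.foldl_append]
  rfl

theorem foldl_blocks {w : Stream' α} {u : ℕ → List α}
    (hu : ∀ i, (w.take (i + 1)).foldl δ s = (w.take (i + 1) ++ u i).foldl δ s) (n : ℕ) :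
    (blocks w u n).foldl δ s = (w.take n).foldl δ s := by
  induction n with
  | zero => rfl
  | succ n ih =>
    rw [hu n, blocks_succ, Stream'.take_succ', List.foldl_append, ih]
    simp [List.foldl_append, -Stream'.concat_take_get]

/-- Since the injected words do not change the state, the run on `w'` enters each block in the state
that the run on `w` has there. A condition along `w'` therefore splits into conditions on single
blocks. -/
theorem eventuallyOnRun_injection {w w' : Stream' α} {u : ℕ → List α} (hw : IsInjection w u w')
    (hu : ∀ i, (w.take (i + 1)).foldl δ s = (w.take (i + 1) ++ u i).foldl δ s) :
    EventuallyOnRun δ s Q w' ↔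
      ∀ᶠ n in atTop, AllOnRun δ Q ((w.take n).foldl δ s) (w.get n :: u n) := by
  have key : ∀ n p x q, w.get n :: u n = p ++ x :: q →
      w'.take ((blocks w u n).length + p.length) = blocks w u n ++ p ∧
      w'.get ((blocks w u n).length + p.length) = x := by
    intro n p x q h
    obtain ⟨v, hv⟩ := hw (n + 1)
    rw [blocks_succ, h] at hv
    have hv' : w' = (blocks w u n ++ p) ++ₛ ([x] ++ₛ (q ++ₛ v)) := by
      rw [hv, ← Stream'.append_append_stream, ← Stream'.append_append_stream]
      simp
    rw [← List.length_append]
    refine ⟨by rw [hv', take_length_append], ?_⟩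
    have := get_append_length_add (blocks w u n ++ p) ([x] ++ₛ (q ++ₛ v)) 0
    rw [hv']
    exact this
  simp only [EventuallyOnRun, eventually_atTop]
  constructor
  · rintro ⟨N, hN⟩
    refine ⟨N, fun n hn => allOnRun_iff.2 fun p x q h => ?_⟩
    obtain ⟨h1, h2⟩ := key n p x q h
    have h3 := hN ((blocks w u n).length + p.length)
      (by have := le_length_blocks w u n; omega)
    rwa [h1, h2, List.foldl_append, foldl_blocks hu] at h3
  · rintro ⟨N, hN⟩
    refine ⟨(blocks w u N).length, fun m hm => ?_⟩
    -- The block containing position `m` is the first one that ends after it.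
    have hex : ∃ n, m < (blocks w u (n + 1)).length := ⟨m, le_length_blocks w u (m + 1)⟩
    obtain ⟨n, hn, hNn, hle⟩ : ∃ n, m < (blocks w u (n + 1)).length ∧ N ≤ n ∧
        (blocks w u n).length ≤ m := by
      classical
      have hmono : Monotone fun n => (blocks w u n).length :=
        monotone_nat_of_le_succ fun n => by simp [blocks_succ]
      refine ⟨Nat.find hex, Nat.find_spec hex, ?_, ?_⟩
      · by_contra! hlt
        have h1 : (blocks w u (Nat.find hex + 1)).length ≤ (blocks w u N).length := hmono hlt
        have h2 := Nat.find_spec hex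
        omega
      · rcases h0 : Nat.find hex with _ | j
        · simp [blocks]
        · exact not_lt.1 (Nat.find_min hex (m := j) (by omega))
    obtain ⟨o, rfl⟩ := Nat.exists_eq_add_of_le hle
    have ho : o < (w.get n :: u n).length := by
      rw [blocks_succ, List.length_append] at hn
      omega
    have hsplit : w.get n :: u n = (w.get n :: u n).take o ++
        (w.get n :: u n)[o] :: (w.get n :: u n).drop (o + 1) := by
      rw [List.getElem_cons_drop, List.take_append_drop]
    have hlen : ((w.get n :: u n).take o).length = o := by
      rw [List.length_take]; omega
    obtain ⟨h1, h2⟩ := key n _ _ _ hsplit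
    rw [hlen] at h1 h2
    rw [h1, h2, List.foldl_append, foldl_blocks hu]
    exact allOnRun_iff.1 (hN n hNn) _ _ _ hsplit

/-- All letters of `w` survive in `w'` and are read in unchanged states, so `w'` meets at least the
violations that `w` meets. -/
theorem EventuallyOnRun.of_extends {L : OmegaLanguage α}
    (hL : ∀ u u', residual L u = residual L u' → u.foldl δ s = u'.foldl δ s)
    {J : Set ℕ} {w w' : Stream' α} (h : Extends L J w w') (hw' : EventuallyOnRun δ s Q w') :
    EventuallyOnRun δ s Q w := by
  obtain ⟨u, -, hu, hi⟩ := h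
  rw [eventuallyOnRun_injection hi fun i => hL _ _ (hu i)] at hw'
  exact hw'.mono fun n hn => hn.1

/-- Injecting a word that loops on all states at infinitely many positions. -/
theorem exists_extends_of_loop {L : OmegaLanguage α}
    (hL : ∀ u u', u.foldl δ s = u'.foldl δ s → residual L u = residual L u')
    {J : Set ℕ} (hJ : J.Infinite) (w : Stream' α) {z : List α} (hz : ∀ v, z.foldl δ v = v) :
    ∃ w', Extends L J w w' ∧ ∀ (Q : S → α → Prop) (c : Prop), (∀ v, AllOnRun δ Q v z ↔ c) →
      (EventuallyOnRun δ s Q w' ↔ EventuallyOnRun δ s Q w ∧ c) := by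
  classical
  let u : ℕ → List α := fun i => if i ∈ J then z else []
  have hu : ∀ i, (w.take (i + 1)).foldl δ s = (w.take (i + 1) ++ u i).foldl δ s := by
    intro i
    by_cases hi : i ∈ J <;> simp [u, hi, List.foldl_append, hz]
  obtain ⟨w', hw'⟩ := exists_isInjection w u
  refine ⟨w', ⟨u, fun i hi => by simp [u, hi], fun i => hL _ _ (hu i), hw'⟩, fun Q c hc => ?_⟩
  rw [eventuallyOnRun_injection hw' hu]
  simp only [AllOnRun, eventually_and]
  refine and_congr Iff.rfl ⟨fun h => ?_, fun h => Eventually.of_forall fun n => ?_⟩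
  -- As `J` is infinite, a copy of `z` is met arbitrarily late.
  · obtain ⟨n, hn, hnJ⟩ := (h.and_frequently (Nat.frequently_atTop_iff_infinite.2 hJ)).exists
    simpa only [u, show n ∈ J from hnJ, if_true, hc] using hn
  · by_cases hn : n ∈ J
    · simpa only [u, hn, if_true, hc] using h
    · simp [u, hn, AllOnRun]

/-- The word `x y x y …`. -/
def alternate (x y : α) : Stream' α := fun n => if Even n then x else y

theorem eventuallyOnRun_alternate {x y : α} (hx : δ s x = s) (hy : δ s y = s) :
    EventuallyOnRun δ s Q (alternate x y) ↔ Q s x ∧ Q s y := by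
  have hrun : ∀ n, ((alternate x y).take n).foldl δ s = s := by
    intro n
    induction n with
    | zero => rfl
    | succ n ih =>
      rw [Stream'.take_succ', List.foldl_append, ih]
      by_cases h : Even n <;> simp [alternate, Stream'.get, h, hx, hy]
  simp only [EventuallyOnRun, hrun]
  constructor
  · intro h
    obtain ⟨N, hN⟩ := eventually_atTop.1 h
    refine ⟨?_, ?_⟩
    · simpa [alternate, Stream'.get] using hN (2 * N) (by omega)
    · simpa [alternate, Stream'.get] using hN (2 * N + 1) (by omega)
  · rintro ⟨h1, h2⟩
    refine Eventually.of_forall fun n => ?_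
    by_cases h : Even n <;> simpa [alternate, Stream'.get, h]

end Run

/-! ### Deterministic automata -/

namespace ParityAutomaton

theorem IsDeterministic.exists_step_eq {A : ParityAutomaton α} (hA : A.IsDeterministic) :
    ∃ δ : A.State → α → A.State, ∀ q x, A.step q x = {δ q x} := by
  choose δ hδ hδ' using hA
  exact ⟨δ, fun q x => Set.eq_singleton_iff_unique_mem.2 ⟨hδ q x, hδ' q x⟩⟩

theorem isRun_iff {A : ParityAutomaton α} {δ : A.State → α → A.State}
    (hδ : ∀ q x, A.step q x = {δ q x}) {w : Stream' α} {r : ℕ → A.State} :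
    A.IsRun w r ↔ r = fun n => (w.take n).foldl δ A.init := by
  constructor
  · rintro ⟨h0, h1⟩
    funext n
    induction n with
    | zero => exact h0
    | succ n ih =>
      have := h1 n
      rw [hδ, Set.mem_singleton_iff, ih] at this
      rw [this, Stream'.take_succ', List.foldl_append]
      rfl
  · rintro rfl
    refine ⟨rfl, fun n => ?_⟩
    beta_reduce
    rw [hδ, Stream'.take_succ', List.foldl_append]
    rfl

theorem mem_language_iff {A : ParityAutomaton α} {δ : A.State → α → A.State}
    (hδ : ∀ q x, A.step q x = {δ q x}) {B : ℕ} (hB : ∀ q x, A.color q x ≤ B) {w : Stream' α} :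
    w ∈ A.language ↔
      Even (limMin fun n => A.color ((w.take n).foldl δ A.init) (w.get n)) := by
  have hl := isLeast_limMin (g := fun n => A.color ((w.take n).foldl δ A.init) (w.get n))
    fun n => hB _ _
  constructor
  · rintro ⟨r, hr, c, hc, hc'⟩
    rw [isRun_iff hδ] at hr
    subst hr
    rwa [hl.unique hc']
  · exact fun h => ⟨_, (isRun_iff hδ).2 rfl, _, h, hl⟩

theorem IsDeterministic.isHistoryDeterministic {A : ParityAutomaton α} (hA : A.IsDeterministic) :
    A.IsHistoryDeterministic := by
  obtain ⟨δ, hδ⟩ := hA.exists_step_eq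
  refine ⟨fun u => u.foldl δ A.init, ?_⟩
  rintro w ⟨r, hr, h⟩
  have h2 := hr
  rw [isRun_iff hδ] at h2
  subst h2
  exact ⟨hr, h⟩

/-- Finitely many states and letters bound the colors, so each run has a least recurring color, and
the shift flips its parity. -/
theorem language_addOne [Finite α] {A : ParityAutomaton α} (hA : A.IsDeterministic) :
    A.addOne.language = A.languageᶜ := by
  obtain ⟨δ, hδ⟩ := hA.exists_step_eq
  have := A.finite_state
  obtain ⟨B, hB⟩ := (Set.finite_range fun p : A.State × α => A.color p.1 p.2).bddAbove
  have hB' : ∀ q x, A.color q x ≤ B := fun q x => hB ⟨(q, x), rfl⟩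
  have hδ' : ∀ q x, A.addOne.step q x = {δ q x} := hδ
  have hB'' : ∀ q x, A.addOne.color q x ≤ B + 1 := fun q x => Nat.succ_le_succ (hB' q x)
  ext w
  rw [Set.mem_compl_iff, mem_language_iff hδ hB', mem_language_iff hδ' hB'', ← Nat.even_add_one]
  have : limMin (fun n => A.addOne.color ((w.take n).foldl δ A.addOne.init) (w.get n)) =
      limMin (fun n => A.color ((w.take n).foldl δ A.init) (w.get n)) + 1 := by
    refine eq_of_forall_le_iff fun i => ?_
    rw [le_limMin_iff fun n => hB'' _ _]
    rcases i with _ | i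
    · simp
    · rw [Nat.add_le_add_iff_right, le_limMin_iff fun n => hB' _ _]
      exact eventually_congr (Eventually.of_forall fun n => Nat.add_le_add_iff_right)
  rw [this]

/-- The deterministic automaton for a transition function and a coloring. -/
def ofStep (S : Type) [Finite S] (δ : S → α → S) (s : S) (c : S → α → ℕ) : ParityAutomaton α where
  State := S
  finite_state := inferInstance
  init := s
  step q x := {δ q x}
  step_nonempty _ _ := Set.singleton_nonempty _
  color := c

section OfStep

variable {S : Type} [Finite S] {δ : S → α → S} {s : S}

theorem isDeterministic_ofStep {c : S → α → ℕ} : (ofStep S δ s c).IsDeterministic :=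
  fun q x => ⟨δ q x, rfl, fun _ h => h⟩

theorem mem_language_ofStep {c : S → α → ℕ} {B : ℕ} (hB : ∀ q x, c q x ≤ B) {w : Stream' α} :
    w ∈ (ofStep S δ s c).language ↔
      Even (limMin fun n => c ((w.take n).foldl δ s) (w.get n)) :=
  mem_language_iff (A := ofStep S δ s c) (fun _ _ => rfl) hB

open Classical in
/-- The deterministic co-Büchi automaton that accepts if eventually `Q` holds along the run. -/
noncomputable def coBuchi (S : Type) [Finite S] (δ : S → α → S) (s : S) (Q : S → α → Prop) :
    ParityAutomaton α :=
  ofStep S δ s fun q x => if Q q x then 2 else 1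

variable {Q : S → α → Prop}

theorem isHDtCBW_coBuchi : (coBuchi S δ s Q).IsHDtCBW :=
  ⟨fun q x => by by_cases h : Q q x <;> simp [coBuchi, ofStep, h],
    isDeterministic_ofStep.isHistoryDeterministic⟩

theorem mem_language_coBuchi {w : Stream' α} :
    w ∈ (coBuchi S δ s Q).language ↔ EventuallyOnRun δ s Q w := by
  classical
  rw [coBuchi, mem_language_ofStep (B := 2) fun q x => by split_ifs <;> omega]
  have hle : ∀ n, (if Q ((w.take n).foldl δ s) (w.get n) then 2 else 1) ≤ 2 := fun n => by
    split_ifs <;> omega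
  have h1 := (le_limMin_iff hle (i := 1)).2 (Eventually.of_forall fun n => by split_ifs <;> omega)
  have h3 : ¬ 3 ≤ limMin _ := fun h =>
    absurd ((le_limMin_iff hle).1 h).exists (by
      rintro ⟨n, hn⟩
      have := hle n
      omega)
  have h2 : 2 ≤ limMin _ ↔ _ := le_limMin_iff hle
  have h4 : EventuallyOnRun δ s Q w ↔ ∀ᶠ n in atTop,
      2 ≤ if Q ((w.take n).foldl δ s) (w.get n) then 2 else 1 :=
    eventually_congr (Eventually.of_forall fun n => by split_ifs <;> simp_all)
  rw [h4, ← h2]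
  constructor
  · rintro ⟨m, hm⟩
    omega
  · intro h
    have : limMin (fun n => if Q ((w.take n).foldl δ s) (w.get n) then 2 else 1) = 2 := by omega
    rw [this]
    decide

end OfStep

/-- History-deterministic automata have at least as many states as their language has non-empty
residual languages. -/
theorem IsHistoryDeterministic.card_le_size {A : ParityAutomaton α}
    (hA : A.IsHistoryDeterministic) {ι : Type} (e : ι → List α)
    (hne : ∀ i, (residual A.language (e i)).Nonempty)
    (hinj : ∀ i j, residual A.language (e i) = residual A.language (e j) → i = j) :
    Nat.card ι ≤ A.size := by
  obtain ⟨f, hf⟩ := hA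
  have := A.finite_state
  refine Nat.card_le_card_of_injective (fun i => f (e i)) fun i j hij => hinj i j ?_
  -- If the advice reaches the same state after `u` and `v`, an accepting run on `v y` can be cut at
  -- `v` and glued to the path for `u`. Nonemptiness ensures that the advice on `u` really is a
  -- path: it belongs to the run on an accepted word `u x`.
  have key : ∀ u v, (residual A.language u).Nonempty → f u = f v →
      residual A.language v ⊆ residual A.language u := by
    rintro u v ⟨x, hx⟩ huv y hy
    obtain ⟨⟨hu0, hu1⟩, -⟩ := hf _ hx
    obtain ⟨⟨-, hv1⟩, c, hc, hc'⟩ := hf _ hy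
    refine ⟨fun n => if n ≤ u.length then f ((u ++ₛ x).take n)
      else f (v ++ y.take (n - u.length)), ⟨by simpa using hu0, fun n => ?_⟩, c, hc, ?_⟩
    · rcases lt_or_ge n u.length with h | h
      · simp only [h.le, if_true, show n + 1 ≤ u.length from h]
        convert hu1 n using 1
        have : ∀ z : Stream' α, some ((u ++ₛ z).get n) = u[n]? := fun z => by
          rw [← Stream'.getElem?_take h, take_length_append]
        rw [← Option.some_inj.1 ((this x).trans (this y).symm)]
      · obtain ⟨m, rfl⟩ := Nat.exists_eq_add_of_le h
        have h2 := hv1 (v.length + m)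
        beta_reduce at h2 ⊢
        rw [Nat.add_assoc, take_append_length_add, take_append_length_add,
          get_append_length_add] at h2
        rw [get_append_length_add]
        rw [if_neg (show ¬ u.length + m + 1 ≤ u.length by omega),
          show u.length + m + 1 - u.length = m + 1 by omega]
        rcases m with _ | m
        · simpa [take_length_append, huv] using h2
        · rw [if_neg (show ¬ u.length + (m + 1) ≤ u.length by omega),
            show u.length + (m + 1) - u.length = m + 1 by omega]
          exact h2
    · convert hc' using 1
      ext d
      refine (frequently_add_iff u.length).symm.trans
        (Iff.trans ?_ (frequently_add_iff v.length))
      refine frequently_congr (Eventually.of_forall fun m => ?_)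
      beta_reduce
      rw [get_append_length_add, get_append_length_add, take_append_length_add v]
      rcases m with _ | m
      · simp [take_length_append, huv]
      · rw [if_neg (show ¬ u.length + (m + 1) ≤ u.length by omega),
          show u.length + (m + 1) - u.length = m + 1 by omega]
  exact (key _ _ (hne j) hij.symm).antisymm (key _ _ (hne i) hij)

end ParityAutomaton

/-! ### Projecting runs to a smaller state space -/

theorem foldl_semiconj {S S' : Type} {δ : S → α → S} {δ' : S' → α → S'} {π : S → S'}
    (hπ : ∀ s x, π (δ s x) = δ' (π s) x) (u : List α) (s : S) :
    π (u.foldl δ s) = u.foldl δ' (π s) := by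
  induction u generalizing s with
  | nil => rfl
  | cons x u ih => rw [List.foldl_cons, ih, hπ, List.foldl_cons]

theorem eventuallyOnRun_semiconj {S S' : Type} {δ : S → α → S} {δ' : S' → α → S'} {π : S → S'}
    (hπ : ∀ s x, π (δ s x) = δ' (π s) x) {s : S} {Q : S' → α → Prop} {w : Stream' α} :
    EventuallyOnRun δ s (fun s x => Q (π s) x) w ↔ EventuallyOnRun δ' (π s) Q w := by
  simp only [EventuallyOnRun, foldl_semiconj hπ]

/-! ### Counting occurrences modulo two -/

open Classical in
/-- The transition function that tracks the parity of the number of occurrences of `x`. -/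
noncomputable def toggle (x : α) (c : Bool) (y : α) : Bool := if y = x then !c else c

theorem foldl_toggle_of_notMem {x : α} {u : List α} (hu : ∀ y ∈ u, y ≠ x) (c : Bool) :
    u.foldl (toggle x) c = c := by
  induction u with
  | nil => rfl
  | cons y u ih =>
    rw [List.foldl_cons, toggle, if_neg (hu y (by simp)), ih fun z hz => hu z (by simp [hz])]

theorem foldl_toggle_flatten {x : α} {l : List (List α)}
    (hl : ∀ u ∈ l, u.foldl (toggle x) false = false) :
    l.flatten.foldl (toggle x) false = false := by
  induction l with
  | nil => rfl
  | cons u l ih =>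
    rw [List.flatten_cons, List.foldl_append, hl u (by simp), ih fun v hv => hl v (by simp [hv])]

/-- For the converse, peel off one factor from the left: a letter other than `x`, or an `x` together
with everything up to the next `x`, which exists because the count is even. -/
theorem mem_evenlyMany_iff {x : α} {u : List α} :
    u ∈ evenlyMany x ↔ u.foldl (toggle x) false = false := by
  constructor
  · intro h
    obtain ⟨l, rfl, hl⟩ := Language.mem_kstar.1 h
    refine foldl_toggle_flatten fun v hv => ?_
    rcases (Language.mem_add _ _ _).1 (hl v hv) with ⟨y, hy, rfl⟩ | h
    · exact foldl_toggle_of_notMem (by simpa using hy) _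
    · obtain ⟨p, hp, q, ⟨y, hy, rfl⟩, rfl⟩ := Language.mem_mul.1 h
      obtain ⟨r, ⟨z, hz, rfl⟩, m, hm, rfl⟩ := Language.mem_mul.1 hp
      obtain ⟨l', rfl, hl'⟩ := Language.mem_kstar.1 hm
      rw [Set.mem_singleton_iff] at hy hz
      subst hy hz
      have : l'.flatten.foldl (toggle z) true = true := foldl_toggle_of_notMem (fun y hy => by
        obtain ⟨v, hv, hy⟩ := List.mem_flatten.1 hy
        obtain ⟨t, ht, rfl⟩ := hl' v hv
        rw [List.mem_singleton.1 hy]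
        simpa using ht) true
      simp only [List.foldl_append, List.foldl_cons, List.foldl_nil]
      rw [show toggle z false z = true by simp [toggle], this]
      simp [toggle]
  · intro h
    have hcons : ∀ p q, p ∈ (letters {x}ᶜ + letters {x} * KStar.kstar (letters {x}ᶜ) *
        letters {x} : Language α) → q ∈ evenlyMany x → p ++ q ∈ evenlyMany x := fun p q hp hq =>
      mul_kstar_le_kstar (a := (letters {x}ᶜ + letters {x} * KStar.kstar (letters {x}ᶜ) *
        letters {x} : Language α)) (Language.append_mem_mul hp hq)
    induction hn : u.length using Nat.strong_induction_on generalizing u with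
    | _ n ih =>
    subst hn
    rcases u with _ | ⟨y, u⟩
    · exact Language.nil_mem_kstar _
    by_cases hy : y = x
    · subst hy
      have hmem : y ∈ u := by
        by_contra hmem
        rw [List.foldl_cons, foldl_toggle_of_notMem fun z hz => ?_] at h
        · simp [toggle] at h
        · rintro rfl
          exact hmem hz
      obtain ⟨m, q, rfl, hm⟩ := List.eq_append_cons_of_mem hmem
      have hm' : ∀ z ∈ m, z ≠ y := by
        rintro z hz rfl
        exact hm hz
      have hq : q.foldl (toggle y) false = false := by
        rw [List.foldl_cons, List.foldl_append, foldl_toggle_of_notMem hm', List.foldl_cons] at h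
        simpa [toggle] using h
      have := hcons ([y] ++ m ++ [y]) q ((Language.mem_add _ _ _).2 (Or.inr
        (Language.append_mem_mul (Language.append_mem_mul ⟨y, rfl, rfl⟩ ?_) ⟨y, rfl, rfl⟩)))
        (ih _ (by simp; omega) hq rfl)
      · simpa using this
      · refine Language.mem_kstar.2 ⟨m.map fun z => [z], ?_, ?_⟩
        · clear hm hm' h ih hmem
          induction m with
          | nil => rfl
          | cons z m ih => simpa using ih
        · intro v hv
          obtain ⟨z, hz, rfl⟩ := List.mem_map.1 hv
          exact ⟨z, hm' z hz, rfl⟩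
    · refine hcons [y] u ((Language.mem_add _ _ _).2 (Or.inl ⟨y, hy, rfl⟩)) (ih _ (by simp) ?_ rfl)
      rwa [List.foldl_cons, toggle, if_neg hy] at h

/-! ### Levels of letters -/

variable {k : ℕ}

/-- The letters whose parity matters: `X i` for `true` and `Y i` for `false`. -/
def mark (b : Bool) (i : Set.Icc 1 k) : Letter k := if b then .X i else .Y i

theorem mark_injective {b b' : Bool} {i i' : Set.Icc 1 k} (h : mark b i = mark b' i') :
    b = b' ∧ i = i' := by
  cases b <;> cases b' <;> simp_all [mark]

/-- The distance of the index of a letter `a h` from the worst one, which is the highest one for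
`true` and the lowest one for `false`. -/
def rank (b : Bool) (h : Fin (4 * k)) : ℕ := if b then 4 * k - 1 - h else h

theorem exists_rank_eq (b : Bool) {r : ℕ} (hr : r < 4 * k) :
    ∃ h : Fin (4 * k), rank b h = r ∧ rank (!b) h = 4 * k - 1 - r := by
  cases b
  · exact ⟨⟨r, hr⟩, by simp [rank]⟩
  · exact ⟨⟨4 * k - 1 - r, by omega⟩, by simp [rank]; omega⟩

/-- The letters that may occur forever on level `i`, given the parity `c`. -/
def Admissible (b : Bool) (i : ℕ) (c : Bool) (x : Letter k) : Prop :=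
  ∃ h, x = .a h ∧ (2 * i ≤ rank b h + 1 ∨ (2 * i ≤ rank b h + 2 ∧ c = false))

/-- The parities of all numbers of occurrences of marks. -/
abbrev Bits (k : ℕ) : Type := Set.Icc 1 k → Bool

/-- The transition function that tracks the parities of all marks for `b`. -/
noncomputable def toggleAll (b : Bool) (v : Bits k) (x : Letter k) : Bits k :=
  fun i => toggle (mark b i) (v i) x

theorem toggleAll_a (b : Bool) (v : Bits k) (h : Fin (4 * k)) : toggleAll b v (.a h) = v := by
  funext i
  cases b <;> simp [toggleAll, toggle, mark]

/-- The letter `x` may occur forever on level `i`, given the parities `v`. -/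
def OnLevel (b : Bool) (v : Bits k) (x : Letter k) (i : ℕ) : Prop :=
  ∃ hi : i ∈ Set.Icc 1 k, Admissible b i (v ⟨i, hi⟩) x

open Classical in
/-- The highest level on which the letter `x` may occur forever. -/
noncomputable def letterLevel (b : Bool) (v : Bits k) (x : Letter k) : ℕ :=
  Nat.findGreatest (OnLevel b v x) k

theorem letterLevel_le (b : Bool) (v : Bits k) (x : Letter k) : letterLevel b v x ≤ k := by
  classical exact Nat.findGreatest_le _

/-- Admissibility is downward closed: a letter admissible on some level above `i` has rank at least
`2 * i`, which admits it on level `i` whatever the parity. -/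
theorem le_letterLevel_iff {b : Bool} {v : Bits k} {x : Letter k} {i : Set.Icc 1 k} :
    (i : ℕ) ≤ letterLevel b v x ↔ Admissible b i (v i) x := by
  classical
  constructor
  · intro h
    have hi := i.2.1
    obtain ⟨hm, y, rfl, hy⟩ := Nat.findGreatest_of_ne_zero (m := letterLevel b v x) rfl (by omega)
    rcases h.eq_or_lt with he | hlt
    · have : i = ⟨_, hm⟩ := Subtype.ext he
      rw [this]
      exact ⟨y, rfl, hy⟩
    · exact ⟨y, rfl, Or.inl (by omega)⟩
  · exact fun h => Nat.le_findGreatest i.2.2 ⟨i.2, h⟩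

theorem letterLevel_eq {b : Bool} {v : Bits k} {x : Letter k} {s : ℕ} (hs : s ≤ k)
    (h : ∀ i : Set.Icc 1 k, Admissible b i (v i) x ↔ (i : ℕ) ≤ s) : letterLevel b v x = s := by
  refine eq_of_forall_le_iff fun i => ?_
  rcases Nat.eq_zero_or_pos i with rfl | hi
  · simp
  by_cases hk : i ≤ k
  · rw [← h ⟨i, hi, hk⟩, ← le_letterLevel_iff]
  · have := letterLevel_le b v x
    omega

theorem letterLevel_mark (b b' : Bool) (v : Bits k) (i : Set.Icc 1 k) :
    letterLevel b v (mark b' i) = 0 := by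
  refine letterLevel_eq (Nat.zero_le k) fun j => ?_
  have := j.2.1
  cases b' <;> simp [Admissible, mark] <;> omega

theorem letterLevel_eq_top {b : Bool} {v : Bits k} {h : Fin (4 * k)} (hk : 2 * k ≤ rank b h + 1) :
    letterLevel b v (.a h) = k :=
  letterLevel_eq le_rfl fun i => ⟨fun _ => i.2.2, fun hi => ⟨h, rfl, Or.inl (by omega)⟩⟩

/-- Odd rank `2 * s - 1` makes the level independent of parities. With `4 * k` letters the rank in
the other family is at least `2 * k`, so the letter is harmless there. -/
theorem exists_letterLevel_eq (b : Bool) {s : ℕ} (h1 : 1 ≤ s) (hk : s ≤ k) :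
    ∃ h : Fin (4 * k), ∀ v, letterLevel b v (.a h) = s ∧ letterLevel (!b) v (.a h) = k := by
  obtain ⟨h, hr, hr'⟩ := exists_rank_eq (k := k) b (r := 2 * s - 1) (by omega)
  refine ⟨h, fun v => ⟨letterLevel_eq hk fun i => ?_, letterLevel_eq_top (by omega)⟩⟩
  simp only [Admissible, Letter.a.injEq, exists_eq_left', hr]
  omega

/-- Even rank `2 * i - 2` is the borderline case in which exactly bit `i` matters. -/
theorem exists_letterLevel_eq_ite (b : Bool) (i : Set.Icc 1 k) :
    ∃ h : Fin (4 * k), ∀ v v', letterLevel b v (.a h) = (if v i then (i : ℕ) - 1 else i) ∧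
      letterLevel (!b) v' (.a h) = k := by
  have h1 := i.2.1
  have h2 := i.2.2
  obtain ⟨h, hr, hr'⟩ := exists_rank_eq (k := k) b (r := 2 * i - 2) (by omega)
  refine ⟨h, fun v v' => ⟨letterLevel_eq (by split_ifs <;> omega) fun j => ?_,
    letterLevel_eq_top (by omega)⟩⟩
  simp only [Admissible, Letter.a.injEq, exists_eq_left', hr]
  by_cases hij : j = i
  · subst hij
    cases v j <;> simp <;> omega
  · have : (j : ℕ) ≠ i := fun h => hij (Subtype.ext h)
    split_ifs <;> omega

/-! ### Levels of words -/

/-- The highest level of the family for `b` that contains `w`. -/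
noncomputable def wordLevel (b : Bool) (w : Stream' (Letter k)) : ℕ :=
  limMin fun n => letterLevel b ((w.take n).foldl (toggleAll b) fun _ => false) (w.get n)

theorem le_wordLevel_iff {b : Bool} {w : Stream' (Letter k)} {i : ℕ} :
    i ≤ wordLevel b w ↔
      EventuallyOnRun (toggleAll b) (fun _ => false) (fun v x => i ≤ letterLevel b v x) w :=
  le_limMin_iff fun _ => letterLevel_le _ _ _

theorem wordLevel_le (b : Bool) (w : Stream' (Letter k)) : wordLevel b w ≤ k := by
  have := (le_wordLevel_iff.1 (le_refl (wordLevel b w))).exists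
  obtain ⟨n, hn⟩ := this
  exact hn.trans (letterLevel_le _ _ _)

/-- A single threshold needs only one bit; this is what makes two-state automata possible. -/
theorem coe_le_wordLevel_iff {b : Bool} {w : Stream' (Letter k)} {i : Set.Icc 1 k} :
    (i : ℕ) ≤ wordLevel b w ↔
      EventuallyOnRun (toggle (mark b i)) false (fun c x => Admissible b i c x) w := by
  rw [le_wordLevel_iff]
  simp only [le_letterLevel_iff]
  exact eventuallyOnRun_semiconj (π := fun v : Bits k => v i) (fun _ _ => rfl)

/-- Once only letters `a h` occur, the parity is frozen. Its final value selects the member of the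
union. -/
theorem mem_thenForever_union_iff {b : Bool} {i : Set.Icc 1 k} {w : Stream' (Letter k)} :
    w ∈ thenForever (evenlyMany (mark b i)) {x | ∃ h, x = .a h ∧ 2 * (i : ℕ) ≤ rank b h + 2} ∪
      thenForever ⊤ {x | ∃ h, x = .a h ∧ 2 * (i : ℕ) ≤ rank b h + 1} ↔ (i : ℕ) ≤ wordLevel b w := by
  rw [coe_le_wordLevel_iff]
  have hconst : ∀ (v : Stream' (Letter k)), (∀ n, ∃ h, v.get n = .a h) → ∀ c n,
      (v.take n).foldl (toggle (mark b i)) c = c := by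
    intro v hv c n
    induction n with
    | zero => rfl
    | succ n ih =>
      obtain ⟨h, hh⟩ := hv n
      rw [Stream'.take_succ', List.foldl_append, ih, hh]
      cases b <;> simp [toggle, mark]
  constructor
  · rintro (⟨u, hu, v, hv, rfl⟩ | ⟨u, -, v, hv, rfl⟩)
    · rw [mem_evenlyMany_iff] at hu
      rw [eventuallyOnRun_append, hu]
      refine Eventually.of_forall fun n => ?_
      rw [hconst v (fun n => (hv n).imp fun h hh => hh.1)]
      obtain ⟨h, h1, h2⟩ := hv n
      exact ⟨h, h1, Or.inr ⟨h2, rfl⟩⟩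
    · rw [eventuallyOnRun_append]
      refine Eventually.of_forall fun n => ?_
      obtain ⟨h, h1, h2⟩ := hv n
      exact ⟨h, h1, Or.inl h2⟩
  · intro h
    obtain ⟨N, hN⟩ := eventually_atTop.1 h
    have hv : ∀ n, ∃ h, (w.drop N).get n = .a h := fun n => by
      rw [Stream'.get_drop]
      exact (hN (N + n) (by omega)).imp fun h hh => hh.1
    have hN' : ∀ n, Admissible b i ((w.take N).foldl (toggle (mark b i)) false)
        ((w.drop N).get n) := fun n => by
      have h2 := hN (N + n) (by omega)
      rwa [← Stream'.get_drop, Stream'.take_add, List.foldl_append, hconst _ hv] at h2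
    cases hc : (w.take N).foldl (toggle (mark b i)) false
    · refine Or.inl ⟨w.take N, mem_evenlyMany_iff.2 hc, w.drop N, fun n => ?_,
        (Stream'.append_take_drop _ _).symm⟩
      obtain ⟨h, h1, h2⟩ := hN' n
      exact ⟨h, h1, by omega⟩
    · refine Or.inr ⟨w.take N, trivial, w.drop N, fun n => ?_,
        (Stream'.append_take_drop _ _).symm⟩
      obtain ⟨h, h1, h2⟩ := hN' n
      rw [hc] at h2
      exact ⟨h, h1, by simpa using h2⟩

theorem mem_Lpart_iff {i : Set.Icc 1 k} {w : Stream' (Letter k)} :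
    w ∈ Lpart k i ↔ (i : ℕ) ≤ wordLevel true w := by
  have h1 := i.2.1
  have h2 := i.2.2
  have e1 : aRange k 0 (4 * k - 2 * i + 1) =
      {x | ∃ h, x = .a h ∧ 2 * (i : ℕ) ≤ rank true h + 2} := by
    refine Set.ext fun x => exists_congr fun h => ?_
    rw [← and_assoc, and_comm]
    refine and_congr_right fun _ => ?_
    simp only [rank, if_true]
    omega
  have e2 : aRange k 0 (4 * k - 2 * i) =
      {x | ∃ h, x = .a h ∧ 2 * (i : ℕ) ≤ rank true h + 1} := by
    refine Set.ext fun x => exists_congr fun h => ?_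
    rw [← and_assoc, and_comm]
    refine and_congr_right fun _ => ?_
    simp only [rank, if_true]
    omega
  rw [← mem_thenForever_union_iff, Lpart, e1, e2]
  rfl

theorem mem_Lhatpart_iff {i : Set.Icc 1 k} {w : Stream' (Letter k)} :
    w ∈ Lhatpart k i ↔ (i : ℕ) ≤ wordLevel false w := by
  have h1 := i.2.1
  have h2 := i.2.2
  have e1 : aRange k (2 * i - 2) (4 * k - 1) =
      {x | ∃ h, x = .a h ∧ 2 * (i : ℕ) ≤ rank false h + 2} := by
    refine Set.ext fun x => exists_congr fun h => ?_
    rw [← and_assoc, and_comm]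
    refine and_congr_right fun _ => ?_
    simp only [rank, Bool.false_eq_true, if_false]
    omega
  have e2 : aRange k (2 * i - 1) (4 * k - 1) =
      {x | ∃ h, x = .a h ∧ 2 * (i : ℕ) ≤ rank false h + 1} := by
    refine Set.ext fun x => exists_congr fun h => ?_
    rw [← and_assoc, and_comm]
    refine and_congr_right fun _ => ?_
    simp only [rank, Bool.false_eq_true, if_false]
    omega
  rw [← mem_thenForever_union_iff, Lhatpart, e1, e2]
  rfl

/-- The language represented by the family for `b`. -/
def evenLevel (k : ℕ) (b : Bool) : OmegaLanguage (Letter k) := {w | Even (wordLevel b w)}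

theorem chainLanguage_familyLevel {b : Bool} {F : Set.Icc 1 k → OmegaLanguage (Letter k)}
    (hF : ∀ i w, w ∈ F i ↔ (i : ℕ) ≤ wordLevel b w) :
    chainLanguage (familyLevel F) = evenLevel k b := by
  refine chainLanguage_eq fun i w => ?_
  change (i = 0 ∨ ∃ h : i ∈ Set.Icc 1 k, w ∈ F ⟨i, h⟩) ↔ _
  simp only [hF]
  have := wordLevel_le b w
  constructor
  · rintro (rfl | ⟨-, h⟩)
    · exact Nat.zero_le _
    · exact h
  · intro h
    rcases Nat.eq_zero_or_pos i with h0 | h0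
    · exact Or.inl h0
    · exact Or.inr ⟨⟨h0, h.trans this⟩, h⟩

theorem L_eq (k : ℕ) : L k = evenLevel k true :=
  chainLanguage_familyLevel fun _ _ => mem_Lpart_iff

theorem Lhat_eq (k : ℕ) : Lhat k = evenLevel k false :=
  chainLanguage_familyLevel fun _ _ => mem_Lhatpart_iff

/-- The transition function that tracks the parities of all marks. -/
noncomputable def toggleBoth (v : Bool → Bits k) (x : Letter k) : Bool → Bits k :=
  fun b => toggleAll b (v b) x

/-- The parities of the numbers of occurrences of all marks in a finite word. -/
noncomputable def parities (u : List (Letter k)) : Bool → Bits k :=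
  u.foldl toggleBoth fun _ _ => false

theorem foldl_toggleBoth (u : List (Letter k)) (v : Bool → Bits k) (b : Bool) :
    u.foldl toggleBoth v b = u.foldl (toggleAll b) (v b) :=
  foldl_semiconj (π := fun v : Bool → Bits k => v b) (fun _ _ => rfl) u v

theorem foldl_toggleAll_eq (u : List (Letter k)) (b : Bool) :
    (u.foldl (toggleAll b) fun _ => false) = parities u b :=
  (foldl_toggleBoth u (fun _ _ => false) b).symm

theorem toggleBoth_a (v : Bool → Bits k) (h : Fin (4 * k)) : toggleBoth v (.a h) = v :=
  funext fun b => toggleAll_a b (v b) h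

theorem le_wordLevel_iff_toggleBoth {b : Bool} {w : Stream' (Letter k)} {i : ℕ} :
    i ≤ wordLevel b w ↔ EventuallyOnRun toggleBoth (fun _ _ => false)
      (fun v x => i ≤ letterLevel b (v b) x) w := by
  rw [le_wordLevel_iff]
  exact (eventuallyOnRun_semiconj (δ := toggleBoth) (δ' := toggleAll b)
    (Q := fun v x => i ≤ letterLevel b v x) (s := fun _ _ => false)
    (π := fun v : Bool → Bits k => v b)
    (fun _ _ => rfl)).symm

theorem exists_parities_eq (v : Bool → Bits k) : ∃ u, parities u = v := by
  classical
  have key : ∀ F : Finset (Bool × Set.Icc 1 k), ∃ u, ∀ b i,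
      parities u b i = decide ((b, i) ∈ F) := by
    intro F
    induction F using Finset.induction_on with
    | empty => exact ⟨[], by simp [parities]⟩
    | insert p F hp ih =>
      obtain ⟨u, hu⟩ := ih
      refine ⟨u ++ [mark p.1 p.2], fun b i => ?_⟩
      have h1 : parities (u ++ [mark p.1 p.2]) b i =
          toggle (mark b i) (parities u b i) (mark p.1 p.2) := by
        simp [parities, toggleBoth, toggleAll]
      rw [h1, hu, toggle]
      by_cases h : mark p.1 p.2 = mark b i
      · have : (b, i) = p := by
          obtain ⟨h1, h2⟩ := mark_injective h
          exact Prod.ext h1.symm h2.symm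
        simp [this, hp, h]
      · have : (b, i) ≠ p := by
          rintro rfl
          exact h rfl
        simp [this, h]
  obtain ⟨u, hu⟩ := key (Finset.univ.filter fun p => v p.1 p.2 = true)
  exact ⟨u, by ext b i; simp [hu]⟩

theorem wordLevel_append_congr {u u' : List (Letter k)} (b : Bool)
    (h : parities u b = parities u' b) (w : Stream' (Letter k)) :
    wordLevel b (u ++ₛ w) = wordLevel b (u' ++ₛ w) := by
  refine eq_of_forall_le_iff fun i => ?_
  rw [le_wordLevel_iff, le_wordLevel_iff, eventuallyOnRun_append, eventuallyOnRun_append,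
    foldl_toggleAll_eq, foldl_toggleAll_eq, h]

theorem wordLevel_append_alternate (b : Bool) (u : List (Letter k)) (h h' : Fin (4 * k)) :
    wordLevel b (u ++ₛ alternate (.a h) (.a h')) =
      min (letterLevel b (parities u b) (.a h)) (letterLevel b (parities u b) (.a h')) := by
  refine eq_of_forall_le_iff fun i => ?_
  rw [le_wordLevel_iff, eventuallyOnRun_append, foldl_toggleAll_eq,
    eventuallyOnRun_alternate (toggleAll_a _ _ _) (toggleAll_a _ _ _), le_min_iff]

theorem wordLevel_append_const_mark (b b' : Bool) (u : List (Letter k)) (i : Set.Icc 1 k) :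
    wordLevel b (u ++ₛ Stream'.const (mark b' i)) = 0 := by
  by_contra h
  have h1 : 1 ≤ wordLevel b (u ++ₛ Stream'.const (mark b' i)) := by omega
  rw [le_wordLevel_iff, eventuallyOnRun_append] at h1
  obtain ⟨n, hn⟩ := h1.exists
  rw [Stream'.get_const, letterLevel_mark] at hn
  omega

/-- A word with given levels, whatever precedes it. -/
theorem exists_wordLevel_eq (t : Bool → ℕ) (ht : ∀ b, 1 ≤ t b ∧ t b ≤ k) :
    ∃ w : Stream' (Letter k), ∀ u b, wordLevel b (u ++ₛ w) = t b := by
  obtain ⟨h, hh⟩ := exists_letterLevel_eq true (ht true).1 (ht true).2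
  obtain ⟨h', hh'⟩ := exists_letterLevel_eq false (ht false).1 (ht false).2
  refine ⟨alternate (.a h) (.a h'), fun u b => ?_⟩
  rw [wordLevel_append_alternate]
  have h1 := hh (parities u b)
  have h2 := hh' (parities u b)
  have h3 := (ht b).2
  rw [Bool.not_true] at h1
  rw [Bool.not_false] at h2
  cases b
  · rw [h1.2, h2.1, min_eq_right h3]
  · rw [h1.1, h2.2, min_eq_left h3]

/-- A word on which one level depends on the parity of a given mark before it, while the other level
is fixed. -/
theorem exists_wordLevel_eq_ite (b : Bool) (i : Set.Icc 1 k) {t : ℕ} (h1 : 1 ≤ t) (hk : t ≤ k) :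
    ∃ w : Stream' (Letter k), ∀ u,
      wordLevel b (u ++ₛ w) = (if parities u b i then (i : ℕ) - 1 else i) ∧
      wordLevel (!b) (u ++ₛ w) = t := by
  obtain ⟨h, hh⟩ := exists_letterLevel_eq_ite b i
  obtain ⟨h', hh'⟩ := exists_letterLevel_eq (!b) h1 hk
  refine ⟨alternate (.a h) (.a h'), fun u => ?_⟩
  have hi := i.2.2
  have e := hh' (parities u b)
  rw [Bool.not_not] at e
  rw [wordLevel_append_alternate, wordLevel_append_alternate, (hh _ (parities u b)).1,
    e.2, (hh (parities u b) _).2, (hh' _).1]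
  exact ⟨min_eq_left (by split_ifs <;> omega), min_eq_right hk⟩

/-! ### Effect of injections on word levels -/

section Extends

variable {L : OmegaLanguage (Letter k)}

theorem wordLevel_le_of_extends {b : Bool}
    (hL : ∀ u u', residual L u = residual L u' → parities u b = parities u' b) {J : Set ℕ}
    {w w' : Stream' (Letter k)} (h : Extends L J w w') : wordLevel b w' ≤ wordLevel b w := by
  rw [le_wordLevel_iff]
  refine EventuallyOnRun.of_extends (fun u u' hu => ?_) h (le_wordLevel_iff.1 le_rfl)
  rw [foldl_toggleAll_eq, foldl_toggleAll_eq]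
  exact hL u u' hu

/-- Inject two letters `a h`, `a h'`, each capping one family and being harmless in the other. They
change no parity, hence no residual. -/
theorem exists_extends_wordLevel_eq_min
    (hL : ∀ u u', parities u = parities u' → residual L u = residual L u') {J : Set ℕ}
    (hJ : J.Infinite) (w : Stream' (Letter k)) (t : Bool → ℕ) (ht : ∀ b, 1 ≤ t b ∧ t b ≤ k) :
    ∃ w', Extends L J w w' ∧ ∀ b, wordLevel b w' = min (wordLevel b w) (t b) := by
  obtain ⟨h, hh⟩ := exists_letterLevel_eq true (ht true).1 (ht true).2
  obtain ⟨h', hh'⟩ := exists_letterLevel_eq false (ht false).1 (ht false).2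
  obtain ⟨w', h1, h2⟩ := exists_extends_of_loop (δ := toggleBoth) (s := fun _ _ => false)
    hL hJ w (z := [.a h, .a h']) fun v => by simp [toggleBoth_a]
  refine ⟨w', h1, fun b => eq_of_forall_le_iff fun i => ?_⟩
  rw [le_wordLevel_iff_toggleBoth, h2 _ (i ≤ t b), le_min_iff, le_wordLevel_iff_toggleBoth]
  intro v
  have h3 := (ht b).2
  have e1 := hh (v b)
  have e2 := hh' (v b)
  rw [Bool.not_true] at e1
  rw [Bool.not_false] at e2
  simp only [AllOnRun, toggleBoth_a, and_true]
  cases b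
  · rw [e1.2, e2.1]; omega
  · rw [e1.1, e2.2]; omega

/-- Inject the same mark twice: the parity is restored, and marks have level 0 in both families. -/
theorem exists_extends_wordLevel_eq_zero (hk : 1 ≤ k)
    (hL : ∀ u u', parities u = parities u' → residual L u = residual L u') {J : Set ℕ}
    (hJ : J.Infinite) (w : Stream' (Letter k)) :
    ∃ w', Extends L J w w' ∧ ∀ b, wordLevel b w' = 0 := by
  let i : Set.Icc 1 k := ⟨1, le_rfl, hk⟩
  obtain ⟨w', h1, h2⟩ := exists_extends_of_loop (δ := toggleBoth) (s := fun _ _ => false)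
    hL hJ w (z := [mark true i, mark true i]) fun v => by
      funext b j
      simp only [List.foldl_cons, List.foldl_nil, toggleBoth, toggleAll, toggle]
      split_ifs <;> simp
  refine ⟨w', h1, fun b => ?_⟩
  by_contra h
  have h3 : 1 ≤ wordLevel b w' := by omega
  rw [le_wordLevel_iff_toggleBoth, h2 _ False] at h3
  · exact h3.2
  · intro v
    simp [AllOnRun, letterLevel_mark]

end Extends

/-! ### The two families -/

/-- Bit `i` is visible in the residual: a suitable continuation lies on level `i` or `i - 1`
according to it, and these differ in parity. -/
theorem residual_evenLevel_eq_iff {b : Bool} (u u' : List (Letter k)) :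
    residual (evenLevel k b) u = residual (evenLevel k b) u' ↔ parities u b = parities u' b := by
  constructor
  · intro h
    funext i
    obtain ⟨w, hw⟩ := exists_wordLevel_eq_ite b i (t := 1) le_rfl (i.2.1.trans i.2.2)
    have h1 : Even (wordLevel b (u ++ₛ w)) ↔ Even (wordLevel b (u' ++ₛ w)) := Set.ext_iff.1 h w
    rw [(hw u).1, (hw u').1] at h1
    obtain ⟨j, hj⟩ : ∃ j, (i : ℕ) = j + 1 := ⟨i - 1, by have := i.2.1; omega⟩
    rw [hj] at h1
    cases e : parities u b i <;> cases e' : parities u' b i <;>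
      simp [e, e', Nat.even_add_one, -Nat.not_even_iff_odd] at h1 ⊢
  · intro h
    ext w
    change Even (wordLevel b (u ++ₛ w)) ↔ Even (wordLevel b (u' ++ₛ w))
    rw [wordLevel_append_congr b h]

theorem isColoring_evenLevel (hk : 1 ≤ k) (b : Bool) :
    IsColoring (evenLevel k b) 0 (wordLevel b) where
  mem_iff _ := Iff.rfl
  le_of_extends _ _ _ h :=
    wordLevel_le_of_extends (fun u u' => (residual_evenLevel_eq_iff u u').1) h
  exists_extends J w hJ hw := by
    have hL : ∀ u u' : List (Letter k), parities u = parities u' →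
        residual (evenLevel k b) u = residual (evenLevel k b) u' := fun u u' h =>
      (residual_evenLevel_eq_iff u u').2 (congrFun h b)
    rcases Nat.lt_or_ge (wordLevel b w) 2 with h | h
    · obtain ⟨w', h1, h2⟩ := exists_extends_wordLevel_eq_zero hk hL hJ w
      exact ⟨w', h1, by rw [h2]; omega⟩
    · have := wordLevel_le b w
      obtain ⟨w', h1, h2⟩ := exists_extends_wordLevel_eq_min hL hJ w (fun _ => wordLevel b w - 1)
        fun _ => by omega
      exact ⟨w', h1, by rw [h2]; omega⟩

theorem mem_level_ofFn {n : ℕ} {F : Fin n → ParityAutomaton α} {d : Stream' α → ℕ}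
    (hF : ∀ i w, w ∈ (F i).language ↔ (i : ℕ) + 1 ≤ d w) (hd : ∀ w, d w ≤ n) (i : ℕ)
    (w : Stream' α) : w ∈ level (List.ofFn F) i ↔ i ≤ d w := by
  rcases i with _ | i
  · simp [level]
  · change (∃ A, (List.ofFn F)[i]? = some A ∧ w ∈ A.language) ↔ _
    rw [List.getElem?_ofFn]
    split_ifs with h
    · simp [hF]
    · have := hd w
      simp only [false_and, exists_false, false_iff]
      omega

theorem exists_isCOCOA_evenLevel (hk : 1 ≤ k) (b : Bool) :
    ∃ A, IsCOCOA (evenLevel k b) A ∧ A.length = k ∧ ∀ B ∈ A, B.size = 2 := by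
  let i : Fin k → Set.Icc 1 k := fun j => ⟨j + 1, by omega, by omega⟩
  let F : Fin k → ParityAutomaton (Letter k) := fun j =>
    ParityAutomaton.coBuchi Bool (toggle (mark b (i j))) false (Admissible b (i j))
  refine ⟨List.ofFn F, (isColoring_evenLevel hk b).isCOCOA zero_le_one ?_ ?_ ?_, by simp, ?_⟩
  · intro A hA
    obtain ⟨j, rfl⟩ := (List.mem_ofFn' F A).1 hA
    exact ParityAutomaton.isHDtCBW_coBuchi
  · refine mem_level_ofFn (fun j w => ?_) (wordLevel_le b)
    rw [ParityAutomaton.mem_language_coBuchi, ← coe_le_wordLevel_iff]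
  · obtain ⟨w, hw⟩ := exists_wordLevel_eq (k := k) (fun _ => k) fun _ => ⟨hk, le_rfl⟩
    refine ⟨w, ?_⟩
    have := hw [] b
    rw [Stream'.nil_append_stream] at this
    rw [this, List.length_ofFn]
    omega
  · intro A hA
    obtain ⟨j, rfl⟩ := (List.mem_ofFn' F A).1 hA
    change Nat.card Bool = 2
    simp

theorem isLeast_size_evenLevel (hk : 1 ≤ k) (b : Bool) :
    IsLeast {n | ∃ P : ParityAutomaton (Letter k),
      P.IsDeterministic ∧ P.language = evenLevel k b ∧ P.size = n} (2 ^ k) := by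
  have hcard : Nat.card (Bits k) = 2 ^ k := by simp [Bits]
  constructor
  · refine ⟨ParityAutomaton.ofStep (Bits k) (toggleAll b) (fun _ => false) (letterLevel b),
      ParityAutomaton.isDeterministic_ofStep, ?_, hcard⟩
    ext w
    exact ParityAutomaton.mem_language_ofStep (letterLevel_le b)
  · rintro n ⟨P, hP, hL, rfl⟩
    choose e he using fun v : Bits k => exists_parities_eq fun _ => v
    rw [← hcard]
    refine hP.isHistoryDeterministic.card_le_size e (fun v => ?_) fun v v' h => ?_
    -- Repeating a mark forever gives the even level 0 after any prefix.
    · refine ⟨Stream'.const (mark b ⟨1, le_rfl, hk⟩), ?_⟩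
      rw [hL]
      change Even (wordLevel b (_ ++ₛ _))
      rw [wordLevel_append_const_mark]
      exact Even.zero
    · rw [hL, residual_evenLevel_eq_iff, he, he] at h
      exact h

/-! ### The union -/

/-- The natural color for the union of a word on levels `s` and `t` of the two families. -/
def unionColor (s t : ℕ) : ℕ :=
  if s = 0 ∨ t = 0 then 0 else if Even s ∧ Even t then s + t - 2 else s + t - 1

theorem even_unionColor (s t : ℕ) : Even (unionColor s t) ↔ Even s ∨ Even t := by
  unfold unionColor
  simp only [Nat.even_iff]
  split_ifs <;> omega

theorem unionColor_comm (s t : ℕ) : unionColor s t = unionColor t s := by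
  unfold unionColor
  simp only [Nat.even_iff]
  split_ifs <;> omega

theorem unionColor_mono {s s' t t' : ℕ} (hs : s ≤ s') (ht : t ≤ t') :
    unionColor s t ≤ unionColor s' t' := by
  unfold unionColor
  simp only [Nat.even_iff]
  split_ifs <;> omega

theorem unionColor_zero_left (t : ℕ) : unionColor 0 t = 0 := by simp [unionColor]

theorem unionColor_lt {s t : ℕ} (hk : 1 ≤ k) (hs : s ≤ k) (ht : t ≤ k) :
    unionColor s t < 2 * k := by
  unfold unionColor
  split_ifs <;> omega

theorem le_unionColor_self (k : ℕ) : k ≤ unionColor k k := by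
  unfold unionColor
  simp only [Nat.even_iff]
  split_ifs <;> omega

/-- Above color 1 the color can be lowered by one with both levels kept positive, so capping by
letters `a h` suffices. Color 1 can only drop to 0, for which a double mark is injected. -/
theorem unionColor_eq_one_or {s t : ℕ} (h : 0 < unionColor s t) :
    unionColor s t = 1 ∨ ∃ s' t', (1 ≤ s' ∧ s' ≤ s) ∧ (1 ≤ t' ∧ t' ≤ t) ∧
      unionColor s' t' + 1 = unionColor s t := by
  by_cases h1 : unionColor s t = 1
  · exact Or.inl h1
  right
  have hst : s ≠ 0 ∧ t ≠ 0 := by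
    by_contra hc
    rw [unionColor, if_pos (by omega)] at h
    omega
  by_cases h2 : s % 2 = 0 ∧ t % 2 = 0
  · refine ⟨s - 1, t - 1, by omega, by omega, ?_⟩
    unfold unionColor
    simp only [Nat.even_iff]
    split_ifs <;> omega
  -- Lower one level without making both even, since that would cost two colors.
  by_cases h3 : 2 ≤ s ∧ (s % 2 = 0 ∨ t % 2 = 1)
  · refine ⟨s - 1, t, by omega, by omega, ?_⟩
    unfold unionColor
    simp only [Nat.even_iff]
    split_ifs <;> omega
  · have ht : 2 ≤ t := by
      by_contra ht
      apply h1
      unfold unionColor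
      simp only [Nat.even_iff]
      split_ifs <;> omega
    refine ⟨s, t - 1, by omega, by omega, ?_⟩
    unfold unionColor
    simp only [Nat.even_iff]
    split_ifs <;> omega

/-- The natural color of a word for the union. -/
noncomputable def wordColor (w : Stream' (Letter k)) : ℕ :=
  unionColor (wordLevel true w) (wordLevel false w)

theorem wordColor_eq (b : Bool) (w : Stream' (Letter k)) :
    wordColor w = unionColor (wordLevel b w) (wordLevel (!b) w) := by
  cases b
  · exact unionColor_comm _ _
  · rfl

theorem mem_union_iff (w : Stream' (Letter k)) : w ∈ L k ∪ Lhat k ↔ Even (wordColor w) := by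
  rw [L_eq, Lhat_eq, wordColor, even_unionColor]
  rfl

theorem wordColor_append_congr {u u' : List (Letter k)} (h : parities u = parities u')
    (w : Stream' (Letter k)) : wordColor (u ++ₛ w) = wordColor (u' ++ₛ w) := by
  rw [wordColor, wordColor, wordLevel_append_congr _ (congrFun h _),
    wordLevel_append_congr _ (congrFun h _)]

theorem residual_union_eq_iff (u u' : List (Letter k)) :
    residual (L k ∪ Lhat k) u = residual (L k ∪ Lhat k) u' ↔ parities u = parities u' := by
  have hmem : ∀ u w, w ∈ residual (L k ∪ Lhat k) u ↔ Even (wordColor (u ++ₛ w)) :=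
    fun u w => mem_union_iff _
  constructor
  · intro h
    funext b i
    obtain ⟨w, hw⟩ := exists_wordLevel_eq_ite b i (t := 1) le_rfl (i.2.1.trans i.2.2)
    have h1 := Set.ext_iff.1 h w
    rw [hmem, hmem, wordColor_eq b, wordColor_eq b, even_unionColor, even_unionColor, (hw u).1,
      (hw u).2, (hw u').1, (hw u').2] at h1
    obtain ⟨j, hj⟩ : ∃ j, (i : ℕ) = j + 1 := ⟨i - 1, by have := i.2.1; omega⟩
    rw [hj] at h1
    cases e : parities u b i <;> cases e' : parities u' b i <;>
      simp [e, e', Nat.even_add_one, -Nat.not_even_iff_odd] at h1 ⊢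
  · intro h
    ext w
    rw [hmem, hmem, wordColor_append_congr h]

theorem isColoring_union (hk : 1 ≤ k) : IsColoring (L k ∪ Lhat k) 0 wordColor where
  mem_iff := mem_union_iff
  le_of_extends _ _ _ h := by
    have hL : ∀ b (u u' : List (Letter k)), residual (L k ∪ Lhat k) u =
        residual (L k ∪ Lhat k) u' → parities u b = parities u' b := fun b u u' h =>
      congrFun ((residual_union_eq_iff u u').1 h) b
    exact unionColor_mono (wordLevel_le_of_extends (hL _) h) (wordLevel_le_of_extends (hL _) h)
  exists_extends J w hJ hw := by
    have hL : ∀ u u' : List (Letter k), parities u = parities u' →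
        residual (L k ∪ Lhat k) u = residual (L k ∪ Lhat k) u' := fun u u' h =>
      (residual_union_eq_iff u u').2 h
    rcases unionColor_eq_one_or hw with h | ⟨s, t, hs, ht, h⟩
    · obtain ⟨w', h1, h2⟩ := exists_extends_wordLevel_eq_zero hk hL hJ w
      refine ⟨w', h1, ?_⟩
      rw [wordColor, h2, unionColor_zero_left, wordColor, h]
    · have h3 := wordLevel_le true w
      have h4 := wordLevel_le false w
      obtain ⟨w', h1, h2⟩ := exists_extends_wordLevel_eq_min hL hJ w (fun b => if b then s else t)
        fun b => by cases b <;> simp <;> omega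
      refine ⟨w', h1, ?_⟩
      rw [wordColor, h2, h2, wordColor, ← h]
      simp [min_eq_right hs.2, min_eq_right ht.2]

theorem exists_wordColor_eq (hk : 1 ≤ k) :
    ∃ w : Stream' (Letter k), ∀ u, wordColor (u ++ₛ w) = unionColor k k := by
  obtain ⟨w, hw⟩ := exists_wordLevel_eq (k := k) (fun _ => k) fun _ => ⟨hk, le_rfl⟩
  exact ⟨w, fun u => by rw [wordColor, hw, hw]⟩

/-- Every automaton for a level of the union is exponentially large. -/
theorem two_pow_le_size {u : ℕ} (h1 : 1 ≤ u) (hu : u ≤ k) {B : ParityAutomaton (Letter k)}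
    (hB : B.IsHistoryDeterministic) (hL : ∀ w, w ∈ B.language ↔ u ≤ wordColor w) :
    2 ^ (u + 1) ≤ B.size := by
  classical
  -- The bits to be remembered, alternating between the families. For even `u` the indices are
  -- consecutive; for odd `u` they are odd, because an even index `i` would make `i` and `u + 1 - i`
  -- both even and miss color `u`.
  let g : Fin (u + 1) → Bool × Set.Icc 1 k := fun j =>
    (decide ((j : ℕ) % 2 = 0), if h : u % 2 = 0 then ⟨j / 2 + 1, by omega, by omega⟩
      else ⟨2 * (j / 2) + 1, by omega, by omega⟩)
  have hg1 : ∀ j, ((g j).1 = decide ((j : ℕ) % 2 = 0)) := fun j => rfl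
  have hg2 : ∀ j, ((g j).2 : ℕ) = if u % 2 = 0 then (j : ℕ) / 2 + 1 else 2 * ((j : ℕ) / 2) + 1 :=
    fun j => by
      by_cases h : u % 2 = 0 <;> simp [g, h]
  have hg : Function.Injective g := by
    intro j j' h
    have e1 : (g j).1 = (g j').1 := by rw [h]
    have e2 : ((g j).2 : ℕ) = (g j').2 := by rw [h]
    rw [hg1, hg1, decide_eq_decide] at e1
    rw [hg2, hg2] at e2
    ext
    split_ifs at e2 <;> omega
  choose e he using fun c : Fin (u + 1) → Bool => exists_parities_eq fun b i =>
    decide (∃ j, g j = (b, i) ∧ c j = true)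
  have he' : ∀ c j, parities (e c) (g j).1 (g j).2 = c j := by
    intro c j
    have : (∃ j', g j' = g j ∧ c j' = true) ↔ c j = true :=
      ⟨fun ⟨j', hj, hc⟩ => hg hj ▸ hc, fun h => ⟨j, rfl, h⟩⟩
    rw [he]
    simp [this]
  have hcard : Nat.card (Fin (u + 1) → Bool) = 2 ^ (u + 1) := by simp
  rw [← hcard]
  refine hB.card_le_size e (fun c => ?_) fun c c' h => ?_
  · obtain ⟨w, hw⟩ := exists_wordColor_eq (k := k) (by omega)
    refine ⟨w, (hL _).2 ?_⟩
    rw [hw]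
    exact hu.trans (le_unionColor_self k)
  · funext j
    have hj := hg2 j
    have hju : ((g j).2 : ℕ) ≤ u := by rw [hj]; split_ifs <;> omega
    have hj1 := (g j).2.2.1
    -- The other level is chosen so that index and level add up to `u + 1`: the color is then
    -- exactly `u` if the bit is unset and below `u` if it is set.
    obtain ⟨w, hw⟩ := exists_wordLevel_eq_ite (g j).1 (g j).2 (t := u + 1 - (g j).2) (by omega)
      (by omega)
    have h2 : u ≤ wordColor (e c ++ₛ w) ↔ u ≤ wordColor (e c' ++ₛ w) := by
      rw [← hL, ← hL]
      exact Set.ext_iff.1 h w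
    rw [wordColor_eq (g j).1, wordColor_eq (g j).1, (hw _).1, (hw _).1, (hw _).2, (hw _).2, he',
      he'] at h2
    have h3 : u ≤ unionColor (g j).2 (u + 1 - (g j).2) := by
      unfold unionColor
      simp only [Nat.even_iff]
      split_ifs at * <;> omega
    have h4 : ¬ u ≤ unionColor ((g j).2 - 1) (u + 1 - (g j).2) := by
      unfold unionColor
      simp only [Nat.even_iff]
      split_ifs at * <;> omega
    cases ec : c j <;> cases ec' : c' j <;> simp_all

/-! ### Cycling through a finite family of conditions -/

section Pointers

variable {S U : Type} {δ : S → α → S} {n : ℕ} (Q : U → ZMod n → S → α → Prop)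

open Classical in
/-- The transition function that runs `δ` and keeps, for each `u`, a pointer to one of the
conditions `Q u j`, which is moved on to the next one whenever that condition fails. -/
noncomputable def pointerStep (δ : S → α → S) (p : S × (U → ZMod n)) (x : α) :
    S × (U → ZMod n) :=
  (δ p.1 x, fun u => if Q u (p.2 u) p.1 x then p.2 u else p.2 u + 1)

/-- If failures stop, the pointer settles on a condition that holds from then on. If condition `j`
holds from some point on, the pointer settles at the latest when it reaches `j`. -/
theorem eventuallyOnRun_pointerStep_iff [NeZero n] {p : S × (U → ZMod n)} {u : U}
    {w : Stream' α} :
    EventuallyOnRun (pointerStep Q δ) p (fun p x => Q u (p.2 u) p.1 x) w ↔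
      ∃ j, EventuallyOnRun δ p.1 (Q u j) w := by
  classical
  let r : ℕ → S × (U → ZMod n) := fun m => (w.take m).foldl (pointerStep Q δ) p
  have hr1 : ∀ m, (r m).1 = (w.take m).foldl δ p.1 := fun m =>
    foldl_semiconj (δ := pointerStep Q δ) (π := Prod.fst) (fun _ _ => rfl) _ _
  have hr2 : ∀ m, (r (m + 1)).2 u = if Q u ((r m).2 u) (r m).1 (w.get m) then (r m).2 u
      else (r m).2 u + 1 := by
    intro m
    simp only [r]
    rw [Stream'.take_succ', List.foldl_append]
    rfl
  constructor
  · intro h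
    obtain ⟨N, hN⟩ := eventually_atTop.1 h
    have hconst : ∀ m, (r (N + m)).2 u = (r N).2 u := by
      intro m
      induction m with
      | zero => rfl
      | succ m ih =>
        rw [← Nat.add_assoc, hr2, if_pos (hN (N + m) (by omega)), ih]
    refine ⟨(r N).2 u, eventually_atTop.2 ⟨N, fun m hm => ?_⟩⟩
    obtain ⟨m, rfl⟩ := Nat.exists_eq_add_of_le hm
    have := hN (N + m) (by omega)
    change Q u ((r (N + m)).2 u) (r (N + m)).1 _ at this
    rwa [hconst, hr1] at this
  · rintro ⟨j, hj⟩
    obtain ⟨N, hN⟩ := eventually_atTop.1 hj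
    -- Induction on the number `d` of cyclic moves still separating the pointer from `j`; each
    -- failure uses up one of them.
    have key : ∀ (d m : ℕ), N ≤ m → (r m).2 u + d = j →
        EventuallyOnRun (pointerStep Q δ) p (fun p x => Q u (p.2 u) p.1 x) w := by
      intro d
      induction d with
      | zero =>
        intro m hm hd
        have hconst : ∀ i, (r (m + i)).2 u = j := by
          intro i
          induction i with
          | zero => simpa using hd
          | succ i ih =>
            have := hN (m + i) (by omega)
            rw [← hr1] at this
            rw [← Nat.add_assoc, hr2, ih, if_pos this]
        refine eventually_atTop.2 ⟨m, fun i hi => ?_⟩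
        obtain ⟨i, rfl⟩ := Nat.exists_eq_add_of_le hi
        change Q u ((r (m + i)).2 u) (r (m + i)).1 _
        rw [hconst, hr1]
        exact hN _ (by omega)
      | succ d ih =>
        intro m hm hd
        by_cases hall : ∀ i, Q u ((r (m + i)).2 u) (r (m + i)).1 (w.get (m + i))
        · refine eventually_atTop.2 ⟨m, fun i hi => ?_⟩
          obtain ⟨i, rfl⟩ := Nat.exists_eq_add_of_le hi
          exact hall i
        · push Not at hall
          have hconst : ∀ i ≤ Nat.find hall, (r (m + i)).2 u = (r m).2 u := by
            intro i
            induction i with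
            | zero => simp
            | succ i ih' =>
              intro hi
              rw [← Nat.add_assoc, hr2, if_pos (not_not.1 (Nat.find_min hall hi)),
                ih' (by omega)]
          refine ih (m + Nat.find hall + 1) (by omega) ?_
          rw [hr2, if_neg (Nat.find_spec hall), hconst _ le_rfl, ← hd]
          push_cast
          ring
    obtain ⟨d, hd⟩ := ZMod.natCast_zmod_surjective (n := n) (j - (r N).2 u)
    exact key d N le_rfl (by rw [hd]; ring)

end Pointers

/-! ### A deterministic automaton for the union -/

/-- The condition that the levels stay at least `j + 1` for the first family and high enough for
color `u + 1` for the second one. -/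
def LevelsOk (u : Fin (2 * k)) (j : ZMod k) (v : Bool → Bits k) (x : Letter k) : Prop :=
  j.val + 1 ≤ letterLevel true (v true) x ∧
    (u : ℕ) + 1 ≤ unionColor (j.val + 1) (letterLevel false (v false) x)

/-- The two levels may attain their minima at different times, so the letterwise color does not
suffice. Fixing a lower bound `j + 1` for the first level turns the rest into a condition on the
second letter level alone. -/
theorem exists_eventuallyOnRun_levelsOk_iff (hk : 1 ≤ k) {u : Fin (2 * k)}
    {w : Stream' (Letter k)} :
    (∃ j, EventuallyOnRun toggleBoth (fun _ _ => false) (LevelsOk u j) w) ↔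
      (u : ℕ) + 1 ≤ wordColor w := by
  have : NeZero k := ⟨by omega⟩
  constructor
  · rintro ⟨j, hj⟩
    have h1 : j.val + 1 ≤ wordLevel true w :=
      le_wordLevel_iff_toggleBoth.2 (hj.mono fun n hn => hn.1)
    -- Infinitely often the second letter level is no higher than the word level, and at such a
    -- moment the condition bounds the color of the whole word.
    have h2 : ¬ wordLevel false w + 1 ≤ wordLevel false w := by omega
    rw [le_wordLevel_iff_toggleBoth] at h2
    obtain ⟨n, hn, hn'⟩ := ((not_eventually.1 h2).and_eventually hj).exists
    exact hn'.2.trans (unionColor_mono h1 (by omega))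
  · intro h
    have hs : wordLevel true w ≠ 0 := fun h0 => by
      rw [wordColor, h0, unionColor_zero_left] at h
      omega
    have hk' := wordLevel_le true w
    have hval : ((wordLevel true w - 1 : ℕ) : ZMod k).val + 1 = wordLevel true w := by
      rw [ZMod.val_natCast_of_lt (by omega)]
      omega
    refine ⟨((wordLevel true w - 1 : ℕ) : ZMod k), ?_⟩
    have h1 := le_wordLevel_iff_toggleBoth.1 (le_refl (wordLevel true w))
    have h2 := le_wordLevel_iff_toggleBoth.1 (le_refl (wordLevel false w))
    filter_upwards [h1, h2] with n hn1 hn2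
    rw [LevelsOk, hval]
    exact ⟨hn1, h.trans (unionColor_mono le_rfl hn2)⟩

/-- The states of a deterministic automaton for the union. -/
abbrev UnionState (k : ℕ) : Type := (Bool → Bits k) × (Fin (2 * k) → ZMod k)

/-- The current condition for color `u + 1` holds. -/
def PointerOk (u : ℕ) (p : UnionState k) (x : Letter k) : Prop :=
  ∃ h : u < 2 * k, LevelsOk ⟨u, h⟩ (p.2 ⟨u, h⟩) p.1 x

theorem eventuallyOnRun_pointerOk_iff (hk : 1 ≤ k) {u : ℕ} {w : Stream' (Letter k)} :
    EventuallyOnRun (pointerStep LevelsOk toggleBoth) (fun _ _ => false, fun _ => 0)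
      (PointerOk u) w ↔ u + 1 ≤ wordColor w := by
  have : NeZero k := ⟨by omega⟩
  by_cases hu : u < 2 * k
  · rw [← exists_eventuallyOnRun_levelsOk_iff hk (u := ⟨u, hu⟩),
      ← eventuallyOnRun_pointerStep_iff (p := (fun _ _ => false, fun _ => 0))]
    exact eventually_congr (Eventually.of_forall fun n => ⟨fun h => h.2, fun h => ⟨hu, h⟩⟩)
  · have h1 := unionColor_lt hk (wordLevel_le true w) (wordLevel_le false w)
    refine ⟨fun h => ?_, fun h => ?_⟩
    · obtain ⟨n, hn⟩ := h.exists
      exact absurd hn.1 hu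
    · rw [wordColor] at h
      omega

/-- The least `u` for which the current condition fails. -/
noncomputable def pointerColor (p : UnionState k) (x : Letter k) : ℕ :=
  sInf {u | ¬ PointerOk u p x}

theorem le_pointerColor_iff {p : UnionState k} {x : Letter k} {i : ℕ} :
    i ≤ pointerColor p x ↔ ∀ u < i, PointerOk u p x := by
  have hne : {u | ¬ PointerOk u p x}.Nonempty := ⟨2 * k, fun h => absurd h.1 (lt_irrefl _)⟩
  constructor
  · intro h u hu
    by_contra hc
    have : pointerColor p x ≤ u := Nat.sInf_le hc
    omega
  · intro h
    by_contra hc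
    exact Nat.sInf_mem hne (h _ (not_le.1 hc))

theorem pointerColor_le (p : UnionState k) (x : Letter k) : pointerColor p x ≤ 2 * k :=
  Nat.sInf_le fun h => absurd h.1 (lt_irrefl _)

/-- The emitted color stays at least `i` exactly when the pointers for all `u < i` eventually stop
failing; since these conditions are nested in `u`, the last one decides. -/
theorem limMin_pointerColor (hk : 1 ≤ k) (w : Stream' (Letter k)) :
    limMin (fun n => pointerColor ((w.take n).foldl (pointerStep LevelsOk toggleBoth)
      (fun _ _ => false, fun _ => 0)) (w.get n)) = wordColor w := by
  refine eq_of_forall_le_iff fun i => ?_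
  rw [le_limMin_iff fun n => pointerColor_le _ _]
  simp only [le_pointerColor_iff]
  have h1 := Finset.eventually_all (Finset.range i) (l := atTop) (p := fun u n =>
    PointerOk u ((w.take n).foldl (pointerStep LevelsOk toggleBoth)
      (fun _ _ => false, fun _ => 0)) (w.get n))
  simp only [Finset.mem_range] at h1
  rw [h1]
  constructor
  · intro h
    rcases i with _ | i
    · exact Nat.zero_le _
    · exact (eventuallyOnRun_pointerOk_iff hk).1 (h i (Nat.lt_succ_self i))
  · exact fun h u hu => (eventuallyOnRun_pointerOk_iff hk).2 (by omega)

theorem exists_deterministic_union (hk : 1 ≤ k) : ∃ P : ParityAutomaton (Letter k),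
    P.IsDeterministic ∧ P.language = L k ∪ Lhat k ∧
      P.size ≤ 2 ^ (4 * k ^ 2) * k ^ (2 * k) := by
  have : NeZero k := ⟨by omega⟩
  refine ⟨ParityAutomaton.ofStep (UnionState k) (pointerStep LevelsOk toggleBoth)
    (fun _ _ => false, fun _ => 0) pointerColor, ParityAutomaton.isDeterministic_ofStep, ?_, ?_⟩
  · ext w
    rw [ParityAutomaton.mem_language_ofStep pointerColor_le, limMin_pointerColor hk, mem_union_iff]
  · have hcard : Nat.card (UnionState k) = (2 ^ k) ^ 2 * k ^ (2 * k) := by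
      rw [Nat.card_prod, Nat.card_fun, Nat.card_fun, Nat.card_fun]
      simp
    change Nat.card (UnionState k) ≤ _
    rw [hcard, ← pow_mul]
    -- The bound is generous: the parities contribute only `2 ^ (2 * k)`.
    exact Nat.mul_le_mul_right _ (Nat.pow_le_pow_right two_pos (by nlinarith))

theorem exists_isCOCOA_union (hk : 1 ≤ k) : ∃ D, IsCOCOA (L k ∪ Lhat k) D := by
  have : NeZero k := ⟨by omega⟩
  -- The length is the largest color that occurs, attained when both levels are `k`.
  let F : Fin (unionColor k k) → ParityAutomaton (Letter k) := fun u =>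
    ParityAutomaton.coBuchi (UnionState k) (pointerStep LevelsOk toggleBoth)
      (fun _ _ => false, fun _ => 0) (PointerOk u)
  refine ⟨List.ofFn F, (isColoring_union hk).isCOCOA zero_le_one ?_ ?_ ?_⟩
  · intro A hA
    obtain ⟨j, rfl⟩ := (List.mem_ofFn' F A).1 hA
    exact ParityAutomaton.isHDtCBW_coBuchi
  · refine mem_level_ofFn (fun j w => ?_)
      fun w => unionColor_mono (wordLevel_le _ w) (wordLevel_le _ w)
    rw [ParityAutomaton.mem_language_coBuchi, eventuallyOnRun_pointerOk_iff hk]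
  · obtain ⟨w, hw⟩ := exists_wordColor_eq hk
    refine ⟨w, ?_⟩
    have := hw []
    rw [Stream'.nil_append_stream] at this
    rw [this, List.length_ofFn]
    omega

theorem exists_universal (α : Type) :
    ∃ U : ParityAutomaton α, U.IsHDtCBW ∧ U.language = Set.univ := by
  refine ⟨ParityAutomaton.coBuchi Unit (fun _ _ => ()) () fun _ _ => True,
    ParityAutomaton.isHDtCBW_coBuchi, Set.eq_univ_of_forall fun w => ?_⟩
  rw [ParityAutomaton.mem_language_coBuchi]
  exact Eventually.of_forall fun _ => trivial

end Cocoa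

theorem mainTheorem6 (k : ℕ) (hk : 1 ≤ k) :
    -- both languages have COCOA with `k` automata of two states each
    (∃ A, Cocoa.IsCOCOA (Cocoa.L k) A ∧ A.length = k ∧ ∀ B ∈ A, B.size = 2) ∧
    (∃ A, Cocoa.IsCOCOA (Cocoa.Lhat k) A ∧ A.length = k ∧ ∀ B ∈ A, B.size = 2) ∧
    -- whereas their smallest deterministic parity automata have `2 ^ k` states
    IsLeast {n | ∃ P : Cocoa.ParityAutomaton (Cocoa.Letter k),
      P.IsDeterministic ∧ P.language = Cocoa.L k ∧ P.size = n} (2 ^ k) ∧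
    IsLeast {n | ∃ P : Cocoa.ParityAutomaton (Cocoa.Letter k),
      P.IsDeterministic ∧ P.language = Cocoa.Lhat k ∧ P.size = n} (2 ^ k) ∧
    -- prepending a universal automaton complements COCOA for these two languages
    (∀ U : Cocoa.ParityAutomaton (Cocoa.Letter k), U.IsHDtCBW → U.language = Set.univ →
      (∀ A, Cocoa.IsCOCOA (Cocoa.L k) A → Cocoa.IsCOCOA (Cocoa.L k)ᶜ (U :: A)) ∧
      (∀ A, Cocoa.IsCOCOA (Cocoa.Lhat k) A → Cocoa.IsCOCOA (Cocoa.Lhat k)ᶜ (U :: A))) ∧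
    -- the conjunction of the complements has a COCOA; its first element is universal, and
    -- removing that element yields a COCOA for the union
    (∃ C, Cocoa.IsCOCOA ((Cocoa.L k)ᶜ ∩ (Cocoa.Lhat k)ᶜ) C) ∧
    (∀ C, Cocoa.IsCOCOA ((Cocoa.L k)ᶜ ∩ (Cocoa.Lhat k)ᶜ) C →
      ∃ U D, C = U :: D ∧ U.language = Set.univ ∧
        Cocoa.IsCOCOA (Cocoa.L k ∪ Cocoa.Lhat k) D) ∧
    -- exponential lower bound for every COCOA for the union
    (∀ D, Cocoa.IsCOCOA (Cocoa.L k ∪ Cocoa.Lhat k) D →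
      ∀ u, 1 ≤ u → u ≤ k → ∃ B, D[u - 1]? = some B ∧ 2 ^ (u + 1) ≤ B.size) ∧
    -- deterministic parity automata are complemented without blow-up by adding one to each color
    (∀ (α : Type) [Finite α] (P : Cocoa.ParityAutomaton α), P.IsDeterministic →
      P.addOne.IsDeterministic ∧ P.addOne.size = P.size ∧ P.addOne.language = P.languageᶜ) ∧
    -- and the union has a deterministic parity automaton within the bound for the conjunction
    (∃ P : Cocoa.ParityAutomaton (Cocoa.Letter k),
      P.IsDeterministic ∧ P.language = Cocoa.L k ∪ Cocoa.Lhat k ∧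
        P.size ≤ 2 ^ (4 * k ^ 2) * k ^ (2 * k)) := by
  have : Nonempty (Cocoa.Letter k) := ⟨.a ⟨0, by omega⟩⟩
  have hcompl : (Cocoa.L k)ᶜ ∩ (Cocoa.Lhat k)ᶜ = (Cocoa.L k ∪ Cocoa.Lhat k)ᶜ :=
    (Set.compl_union _ _).symm
  have hL := Cocoa.L_eq k
  have hLhat := Cocoa.Lhat_eq k
  refine ⟨hL ▸ Cocoa.exists_isCOCOA_evenLevel hk true,
    hLhat ▸ Cocoa.exists_isCOCOA_evenLevel hk false,
    hL ▸ Cocoa.isLeast_size_evenLevel hk true, hLhat ▸ Cocoa.isLeast_size_evenLevel hk false,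
    fun U hU hU' => ⟨?_, ?_⟩, ?_, ?_, fun D hD u h1 hu => ?_,
    fun α _ P hP => ⟨hP, rfl, Cocoa.ParityAutomaton.language_addOne hP⟩,
    Cocoa.exists_deterministic_union hk⟩
  · rw [hL]
    exact fun A hA => (Cocoa.isColoring_evenLevel hk true).isCOCOA_cons hU hU' hA
  · rw [hLhat]
    exact fun A hA => (Cocoa.isColoring_evenLevel hk false).isCOCOA_cons hU hU' hA
  · obtain ⟨D, hD⟩ := Cocoa.exists_isCOCOA_union hk
    obtain ⟨U, hU, hU'⟩ := Cocoa.exists_universal (Cocoa.Letter k)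
    rw [hcompl]
    exact ⟨U :: D, (Cocoa.isColoring_union hk).isCOCOA_cons hU hU' hD⟩
  · rw [hcompl]
    exact fun C hC => (Cocoa.isColoring_union hk).exists_cons hC
  · have hlev := (Cocoa.isColoring_union hk).mem_level_iff zero_le_one hD
    obtain ⟨j, rfl⟩ : ∃ j, u = j + 1 := ⟨u - 1, by omega⟩
    obtain ⟨w, hw⟩ := Cocoa.exists_wordColor_eq hk
    -- A word on level `k` in both families has color at least `k`, so the chain does reach index
    -- `u`.
    have hmem := (hlev (j + 1) ([] ++ₛ w)).2
      (by rw [hw]; exact hu.trans (Cocoa.le_unionColor_self k))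
    obtain ⟨B, hB, -⟩ := hmem
    refine ⟨B, hB, Cocoa.two_pow_le_size h1 hu (hD.isHDtCBW B (List.mem_of_getElem? hB)).2
      fun v => ?_⟩
    rw [← hlev]
    exact ⟨fun h => ⟨B, hB, h⟩, fun ⟨B', hB', h⟩ => Option.some_inj.1 (hB'.symm.trans hB) ▸ h⟩
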